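/- Let $d\in\mathbb N$, $T>0$, $c\in[1,T+1)$, $\delta\in(0,1)$, $\gamma\in[0,1/2]$, and $q(s,t)=\max\{s^\gamma(t-s)^\gamma,\delta\}$ for $0\le s\le t$ (so $q\equiv 1$ if $\gamma=0$). Let $(Y_i)_{i\in\mathbb Z}$ and $(Z_i)_{i\in\mathbb Z}$ be strictly stationary sequences of $d$-dimensional random vectors on a common probability space, with continuous univariate margins and with contemporary distribution functions $F(x)=\Pr(Y_0\le x)$ and $G(x)=\Pr(Z_0\le x)$, $x\in\mathbb R^d$ (inequalities componentwise), where $G\ne F$. For a stationary sequence $W$ let $\alpha_r^W=\sup|\Pr(A\cap B)-\Pr(A)\Pr(B)|$, $r\ge 1$, the supremum being over $A\in\sigma(W_i,i\le 0)$ and $B\in\sigma(W_i,i\ge r)$. Assume $\alpha_r^Y=O(r^{-a})$ and $\alpha_r^Z=O(r^{-b})$ as $r\to\infty$ for some $a,b>1$. For every $m\ge 1$ let $X_i=Y_i$ for $1\le i\le\lfloor mc\rfloor$ and $X_i=Z_i$ for $\lfloor mc\rfloor<i\le\lfloor m(T+1)\rfloor$. Put $F_{j:k}(x)=\frac1{k-j+1}\sum_{i=j}^k\mathbf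 1(X_i\le x)$ if $j\le k$ and $F_{j:k}=0$ otherwise, $\lambda_m(s,t)=(\lfloor mt\rfloor-\lfloor ms\rfloor)/m$, $\Delta=\{(s,t)\in[0,T+1]^2: s\le t\}$ and, for $(s,t)\in\Delta$ and $x\in\mathbb R^d$, $$H_m(s,t,x)=\sqrt m\,\lambda_m(0,s)\lambda_m(s,t)\{F_{1:\lfloor ms\rfloor}(x)-F_{\lfloor ms\rfloor+1:\lfloor mt\rfloor}(x)\},\qquad H_{m,q}(s,t,x)=\frac{H_m(s,t,x)}{q\{\lambda_m(0,s),\lambda_m(0,t)\}}.$$ For $m\le j<k$ let $w_{j,k}(x)=\frac{j(k-j)}{m^{3/2}q(j/m,k/m)}\{F_{1:j}(x)-F_{j+1:k}(x)\}$. For $k>m$ define $$R_{m,q}(k)=\max_{m\le j\le k-1}\sup_{x\in\mathbb R^d}|w_{j,k}(x)|,\quad S_{m,q}(k)=\max_{m\le j\le k-1}\frac1k\sum_{i=1}^k w_{j,k}(X_i)^2,\quad T_{m,q}(k)=\frac1m\sum_{j=m}^{k-1}\frac1k\sum_{i=1}^k w_{j,k}(X_i)^2,$$ and $R_{m,q}(m)=S_{m,q}(m)=T_{m,q}(m)=0$.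 Then, as $m\to\infty$: 1. $m^{-1/2}H_m\to K_c$ in probability in $\ell^\infty(\Delta\times\mathbb R^d)$, where $K_c(s,t,x)=(s\wedge c)\{(t\vee c)-(s\vee c)\}\{F(x)-G(x)\}$. 2. $m^{-1/2}H_{m,q}\to K_{c,q}$ in probability in $\ell^\infty(\Delta\times\mathbb R^d)$, where $K_{c,q}(s,t,x)=K_c(s,t,x)/q(s,t)$. 3. $\sup_{t\in[1,T+1]}R_{m,q}(\lfloor mt\rfloor)\to\infty$ in probability. 4. $\sup_{t\in[1,T+1]}S_{m,q}(\lfloor mt\rfloor)\to\infty$ and $\sup_{t\in[1,T+1]}T_{m,q}(\lfloor mt\rfloor)\to\infty$ in probability whenever $d=1$, or the laws of $Y_0$ and $Z_0$ are both absolutely continuous with respect to Lebesgue measure, or, more generally, $\Pr\{F(Y_0)\ne G(Y_0)\}>0$ or $\Pr\{F(Z_0)\ne G(Z_0)\}>0$. -/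

import Mathlib

open MeasureTheory ProbabilityTheory Filter Topology Asymptotics

noncomputable section

namespace SeqChange

/-! ### Stationarity, strong mixing, continuity of random vectors -/

section Sequences

variable {Ω : Type*} [MeasurableSpace Ω] {d : ℕ}

/-- Strict stationarity of a two-sided sequence of random vectors: every shift of the
sequence has the same law, on the space of sequences, as the sequence itself. -/
def Stationary (P : Measure Ω) (Y : ℤ → Ω → Fin d → ℝ) : Prop :=
  ∀ h : ℤ, P.map (fun ω (i : ℤ) => Y (i + h) ω) = P.map (fun ω (i : ℤ) => Y i ω)

/-- The σ-field generated by the vectors `Y i`, `i ∈ I`. -/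
abbrev sigmaField (Y : ℤ → Ω → Fin d → ℝ) (I : Set ℤ) : MeasurableSpace Ω :=
  ⨆ i ∈ I, MeasurableSpace.comap (Y i) inferInstance

/-- The strong mixing coefficients: `α 0 = 1 / 2` and, for `r ≥ 1`, the supremum of
`|P(A ∩ B) - P(A) P(B)|` over `A` in the past up to time `0` and `B` in the future from
time `r`. -/
def mixingCoeff (P : Measure Ω) (Y : ℤ → Ω → Fin d → ℝ) (r : ℕ) : ℝ :=
  if r = 0 then 1 / 2
  else sSup {a : ℝ | ∃ A B : Set Ω,
    MeasurableSet[sigmaField Y (Set.Iic 0)] A ∧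
    MeasurableSet[sigmaField Y (Set.Ici (r : ℤ))] B ∧
    a = |P.real (A ∩ B) - P.real A * P.real B|}

/-- All univariate margins of the random vector `X` have a continuous distribution function
(equivalently, the joint distribution function of `X` is continuous). -/
def ContinuousVector (P : Measure Ω) (X : Ω → Fin d → ℝ) : Prop :=
  ∀ (k : Fin d) (a : ℝ), P {ω | X ω k = a} = 0

/-- The (joint) distribution function of a random vector; `≤` is componentwise. -/
def distFun (P : Measure Ω) (X : Ω → Fin d → ℝ) (x : Fin d → ℝ) : ℝ :=
  P.real {ω | X ω ≤ x}

/-- The sequence that follows `Y` up to and including time `k` and `Z` afterwards. -/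
def changeAt (Y Z : ℤ → Ω → Fin d → ℝ) (k : ℕ) (ω : Ω) (i : ℕ) : Fin d → ℝ :=
  if i ≤ k then Y i ω else Z i ω

/-- Convergence in probability in `ℓ^∞(S)`: the maps and the limit are bounded on `S`, and
the uniform distance tends to zero in (outer) probability. -/
def TendstoInProbLinfty {α : Type*} (P : Measure Ω) (S : Set α)
    (f : ℕ → Ω → α → ℝ) (g : α → ℝ) : Prop :=
  (∀ m ω, BddAbove ((fun p => |f m ω p|) '' S)) ∧
  BddAbove ((fun p => |g p|) '' S) ∧
  ∀ ε : ℝ, 0 < ε →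
    Tendsto (fun m => P {ω | ε < ⨆ p : S, |f m ω p - g p|}) atTop (𝓝 0)

/-- Divergence to `+∞` in (outer) probability of a sequence of real random variables. -/
def TendstoInProbTop (P : Measure Ω) (f : ℕ → Ω → ℝ) : Prop :=
  ∀ M : ℝ, Tendsto (fun m => P {ω | f m ω ≤ M}) atTop (𝓝 0)

end Sequences

/-! ### Empirical distribution functions and detectors

These are functions of the data `x 1, x 2, …` (the entry `x 0` is never used). -/

section Detectors

variable {d : ℕ}

/-- The empirical distribution function of the stretch `x j, …, x k`. -/
def empDF (x : ℕ → Fin d → ℝ) (j k : ℕ) (y : Fin d → ℝ) : ℝ :=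
  if j ≤ k then
    (1 / ((k : ℝ) - j + 1)) * ∑ i ∈ Finset.Icc j k, {z | x i ≤ z}.indicator (fun _ => (1 : ℝ)) y
  else 0

/-- The weight function `q`. -/
def weightQ (γ δ s t : ℝ) : ℝ := max (s ^ γ * (t - s) ^ γ) δ

/-- The weighted difference of empirical distribution functions
`j (k - j) / (m^{3/2} q(j/m, k/m)) {F_{1:j} - F_{j+1:k}}`. -/
def wdiff (γ δ : ℝ) (m : ℕ) (x : ℕ → Fin d → ℝ) (j k : ℕ) (y : Fin d → ℝ) : ℝ :=
  (j * ((k : ℝ) - j)) / ((m : ℝ) ^ (3 / 2 : ℝ) * weightQ γ δ (j / m) (k / m)) *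
    (empDF x 1 j y - empDF x (j + 1) k y)

/-- The Kolmogorov–Smirnov type detector (for `k = m` the maximum is over the empty set and
the value is `0`). -/
def detR (γ δ : ℝ) (m : ℕ) (x : ℕ → Fin d → ℝ) (k : ℕ) : ℝ :=
  ⨆ j : Set.Ico m k, ⨆ y : Fin d → ℝ, |wdiff γ δ m x j k y|

/-- The first Cramér–von Mises type detector (again `0` for `k = m`). -/
def detS (γ δ : ℝ) (m : ℕ) (x : ℕ → Fin d → ℝ) (k : ℕ) : ℝ :=
  ⨆ j : Set.Ico m k, (1 / (k : ℝ)) * ∑ i ∈ Finset.Icc 1 k, (wdiff γ δ m x j k (x i)) ^ 2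

/-- The second Cramér–von Mises type detector (again `0` for `k = m`). -/
def detT (γ δ : ℝ) (m : ℕ) (x : ℕ → Fin d → ℝ) (k : ℕ) : ℝ :=
  (1 / (m : ℝ)) * ∑ j ∈ Finset.Ico m k,
    (1 / (k : ℝ)) * ∑ i ∈ Finset.Icc 1 k, (wdiff γ δ m x j k (x i)) ^ 2

/-- The supremum over `t ∈ [1, T + 1]` of `D ⌊m t⌋`. -/
def supDet (T : ℝ) (m : ℕ) (D : ℕ → ℝ) : ℝ :=
  ⨆ t : Set.Icc (1 : ℝ) (T + 1), D ⌊(m : ℝ) * t⌋₊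

/-- `λ_m(s, t) = (⌊m t⌋ - ⌊m s⌋) / m`. -/
def lam (m : ℕ) (s t : ℝ) : ℝ := ((⌊(m : ℝ) * t⌋₊ : ℝ) - ⌊(m : ℝ) * s⌋₊) / m

/-- The triangle `Δ = {(s, t) ∈ [0, T + 1]² : s ≤ t}`. -/
def Delta (T : ℝ) : Set (ℝ × ℝ) :=
  {p | 0 ≤ p.1 ∧ p.1 ≤ p.2 ∧ p.2 ≤ T + 1}

/-- The process `H_m(s, t, y)`. -/
def procH (m : ℕ) (x : ℕ → Fin d → ℝ) (s t : ℝ) (y : Fin d → ℝ) : ℝ :=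
  √(m : ℝ) * lam m 0 s * lam m s t *
    (empDF x 1 ⌊(m : ℝ) * s⌋₊ y - empDF x (⌊(m : ℝ) * s⌋₊ + 1) ⌊(m : ℝ) * t⌋₊ y)

/-- The weighted process `H_{m,q}(s, t, y)`. -/
def procHq (γ δ : ℝ) (m : ℕ) (x : ℕ → Fin d → ℝ) (s t : ℝ) (y : Fin d → ℝ) : ℝ :=
  procH m x s t y / weightQ γ δ (lam m 0 s) (lam m 0 t)

/-- The limit `K_c(s, t, y) = (s ∧ c) {(t ∨ c) - (s ∨ c)} {F(y) - G(y)}`. -/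
def limK (c : ℝ) (F G : (Fin d → ℝ) → ℝ) (s t : ℝ) (y : Fin d → ℝ) : ℝ :=
  min s c * (max t c - max s c) * (F y - G y)

end Detectors

end SeqChange

end

open SeqChange

namespace SeqChange

/-! Split the number of visits to a set up to time `k` into its centre and a centred count. Summable
mixing coefficients make the variance of the centred count of order `k`, so Chebyshev gives a weak
law at each time; counts are Lipschitz in `k`, so finitely many grid times make it uniform over
initial stretches (`tendsto_measure_exists_centredCount`). Since the margins are continuous,
finitely many brackets of small mass serve all lower orthants, which gives uniformity in the space
variable as well (`tendsto_measure_exists_centredCount_Iic`). With a change point, the deviation is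
a signed sum of three centred counts, each of `Y` alone or of `Z` alone, so the joint law of the two
sequences plays no role, and `NearCentre` holds with probability tending to one.

On that event everything is deterministic. The rescaled process is a polynomial in rescaled counts
and times (`abs_procH_sub_limK_le`), and the weight, continuous and at least `δ`, passes to the
limit (`exists_procHq_close`). After the change the limit is bounded away from zero where `F` and
`G` differ by more than `θ`, so the weighted difference there is of order `√m`
(`exists_mul_sqrt_le_abs_procHq`). One such point is enough for `detR`. The Cramér–von Mises
detectors average over the observations, so a positive fraction of these must fall where `F` and `G`
differ; the weak law for that set provides it once the set has positive probability.

That positivity follows from `G ≠ F` in dimension one by looking at the maximum of a compact set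
(`measure_Iic_ne_of_lt`), and for absolutely continuous laws by differentiating along small boxes
whose vertices all lie in the agreement set (`eq_of_ae_Iic_eq`). -/

lemma measurableSet_sigmaField {Ω : Type*} {d : ℕ} {W : ℤ → Ω → Fin d → ℝ}
    {A : Set (Fin d → ℝ)} (hA : MeasurableSet A) {I : Set ℤ} {i : ℤ}
    (hi : i ∈ I) : MeasurableSet[sigmaField W I] (W i ⁻¹' A) := by
  have h : MeasurableSpace.comap (W i) inferInstance ≤ sigmaField W I :=
    le_iSup₂ (f := fun i (_ : i ∈ I) => MeasurableSpace.comap (W i) inferInstance) i hi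
  exact h _ ⟨A, hA, rfl⟩

/-! ### Covariance bounds from mixing and the uniform weak law. -/

section Mixing

variable {Ω : Type*} [MeasurableSpace Ω] {P : Measure Ω} {d : ℕ} {W : ℤ → Ω → Fin d → ℝ}

lemma Stationary.map_pair (hs : Stationary P W) (hm : ∀ i, Measurable (W i)) (i j h : ℤ) :
    P.map (fun ω => (W (i + h) ω, W (j + h) ω)) = P.map (fun ω => (W i ω, W j ω)) := by
  have hφ : Measurable (fun w : ℤ → Fin d → ℝ => (w i, w j)) := by fun_prop
  have h1 : Measurable fun ω (k : ℤ) => W (k + h) ω := measurable_pi_lambda _ fun k => hm _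
  have h0 : Measurable fun ω (k : ℤ) => W k ω := measurable_pi_lambda _ fun k => hm _
  have key := congrArg (fun ν => ν.map fun w : ℤ → Fin d → ℝ => (w i, w j)) (hs h)
  rw [Measure.map_map hφ h1, Measure.map_map hφ h0] at key
  exact key

lemma Stationary.measureReal_inter (hs : Stationary P W) (hm : ∀ i, Measurable (W i))
    {A : Set (Fin d → ℝ)} (hA : MeasurableSet A) (i j h : ℤ) :
    P.real (W (i + h) ⁻¹' A ∩ W (j + h) ⁻¹' A) = P.real (W i ⁻¹' A ∩ W j ⁻¹' A) := by
  have key := congrArg (fun ν => ν.real (A ×ˢ A)) (hs.map_pair hm i j h)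
  rw [map_measureReal_apply ((hm _).prodMk (hm _)) (hA.prod hA),
    map_measureReal_apply ((hm _).prodMk (hm _)) (hA.prod hA)] at key
  exact key

lemma Stationary.measureReal_preimage (hs : Stationary P W) (hm : ∀ i, Measurable (W i))
    {A : Set (Fin d → ℝ)} (hA : MeasurableSet A) (i : ℤ) :
    P.real (W i ⁻¹' A) = P.real (W 0 ⁻¹' A) := by
  simpa using hs.measureReal_inter hm hA 0 0 i

lemma mixingCoeff_nonneg (r : ℕ) : 0 ≤ mixingCoeff P W r := by
  rw [mixingCoeff]
  split_ifs
  · norm_num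
  · apply Real.sSup_nonneg
    rintro _ ⟨A, B, -, -, rfl⟩
    exact abs_nonneg _

/-- The series is indexed by `ℤ` because the covariances of a fixed index with all others run over
lags of both signs. -/
lemma summable_mixingCoeff {a : ℝ} (ha : 1 < a)
    (hα : (fun r : ℕ => mixingCoeff P W r) =O[atTop] fun r : ℕ => (r : ℝ) ^ (-a)) :
    Summable fun z : ℤ => mixingCoeff P W z.natAbs := by
  have h : Summable fun r : ℕ => mixingCoeff P W r :=
    summable_of_isBigO_nat (Real.summable_nat_rpow.2 (by linarith)) hα
  exact Summable.of_nat_of_neg (by simpa using h) (by simpa using h)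

lemma integral_indicator_comp (hm : ∀ i, Measurable (W i)) {A : Set (Fin d → ℝ)}
    (hA : MeasurableSet A) (i : ℤ) :
    ∫ ω, A.indicator (fun _ => (1 : ℝ)) (W i ω) ∂P = P.real (W i ⁻¹' A) := by
  have : (fun ω => A.indicator (fun _ => (1 : ℝ)) (W i ω)) = (W i ⁻¹' A).indicator 1 := by
    ext ω; by_cases h : W i ω ∈ A <;> simp [h]
  rw [this, integral_indicator_one (hm i hA)]

variable [IsProbabilityMeasure P]

lemma abs_inter_sub_mul_le_one (A B : Set Ω) :
    |P.real (A ∩ B) - P.real A * P.real B| ≤ 1 := by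
  have h1 : P.real (A ∩ B) ≤ 1 := measureReal_le_one
  have h2 : P.real A ≤ 1 := measureReal_le_one
  have h3 : P.real B ≤ 1 := measureReal_le_one
  have h4 : P.real A * P.real B ≤ 1 := mul_le_one₀ h2 measureReal_nonneg h3
  have h5 : 0 ≤ P.real A * P.real B := mul_nonneg measureReal_nonneg measureReal_nonneg
  have h6 : 0 ≤ P.real (A ∩ B) := measureReal_nonneg
  rw [abs_le]
  constructor <;> linarith

lemma abs_inter_sub_sq_le_mixingCoeff (hs : Stationary P W) (hm : ∀ i, Measurable (W i))
    {A : Set (Fin d → ℝ)} (hA : MeasurableSet A) (i j : ℤ) :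
    |P.real (W i ⁻¹' A ∩ W j ⁻¹' A) - P.real (W i ⁻¹' A) * P.real (W j ⁻¹' A)| ≤
      mixingCoeff P W (j - i).natAbs := by
  wlog hij : i ≤ j generalizing i j
  · have := this j i (by omega)
    rw [Set.inter_comm, mul_comm, ← Int.natAbs_neg, neg_sub]
    exact this
  obtain ⟨r, rfl⟩ := Int.le.dest hij
  have hr : (i + (r : ℤ) - i).natAbs = r := by omega
  rw [hr, hs.measureReal_preimage hm hA i, hs.measureReal_preimage hm hA (i + r)]
  have hinter := hs.measureReal_inter hm hA 0 r i
  rw [zero_add, add_comm (r : ℤ) i] at hinter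
  rw [hinter, mixingCoeff]
  -- At lag zero the covariance is `p - p ^ 2`, below the conventional value `1 / 2`; at positive
  -- lags the two events compete in the supremum.
  split_ifs with h0
  · subst h0
    have h1 : P.real (W 0 ⁻¹' A) ≤ 1 := measureReal_le_one
    have h2 : 0 ≤ P.real (W 0 ⁻¹' A) := measureReal_nonneg
    simp only [Nat.cast_zero, Set.inter_self]
    rw [abs_le]
    constructor <;> nlinarith
  · refine le_csSup ⟨1, ?_⟩ ⟨W 0 ⁻¹' A, W r ⁻¹' A, measurableSet_sigmaField hA (by simp),
      measurableSet_sigmaField hA (by simp), ?_⟩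
    · rintro _ ⟨A, B, -, -, rfl⟩
      exact abs_inter_sub_mul_le_one A B
    · rw [hs.measureReal_preimage hm hA r]

/-- The centred number of visits of `A` up to time `k`. -/
noncomputable def centredCount (P : Measure Ω) (W : ℤ → Ω → Fin d → ℝ) (A : Set (Fin d → ℝ))
    (k : ℕ) (ω : Ω) : ℝ :=
  ∑ i ∈ Finset.Icc 1 k, A.indicator (fun _ => (1 : ℝ)) (W i ω) - k * P.real (W 0 ⁻¹' A)

lemma memLp_indicator_comp (hm : ∀ i, Measurable (W i)) {A : Set (Fin d → ℝ)}
    (hA : MeasurableSet A) (i : ℤ) :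
    MemLp (fun ω => A.indicator (fun _ => (1 : ℝ)) (W i ω)) 2 P := by
  refine MemLp.of_bound ((measurable_const.indicator hA).comp (hm i)).aestronglyMeasurable 1
    (ae_of_all _ fun ω => ?_)
  by_cases h : W i ω ∈ A <;> simp [h]

/-- Each row of the covariance matrix is dominated by the full two-sided mixing series, and there
are `k` rows. -/
lemma variance_centredCount_le (hs : Stationary P W) (hm : ∀ i, Measurable (W i))
    (hsum : Summable fun z : ℤ => mixingCoeff P W z.natAbs) {A : Set (Fin d → ℝ)}
    (hA : MeasurableSet A) (k : ℕ) :
    Var[fun ω => ∑ i ∈ Finset.Icc 1 k, A.indicator (fun _ => (1 : ℝ)) (W i ω); P] ≤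
      k * ∑' z : ℤ, mixingCoeff P W z.natAbs := by
  have hL := memLp_indicator_comp (P := P) hm hA
  have hfun : (fun ω => ∑ i ∈ Finset.Icc 1 k, A.indicator (fun _ => (1 : ℝ)) (W i ω)) =
      ∑ i ∈ Finset.Icc 1 k, fun ω => A.indicator (fun _ => (1 : ℝ)) (W i ω) := by
    ext ω; simp
  rw [hfun, variance_sum' fun (i : ℕ) _ => hL i]
  calc _ ≤ ∑ i ∈ Finset.Icc 1 k, ∑' z : ℤ, mixingCoeff P W z.natAbs := ?_
    _ = _ := by simp
  refine Finset.sum_le_sum fun i _ => ?_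
  calc _ ≤ ∑ j ∈ Finset.Icc 1 k, mixingCoeff P W ((j : ℤ) - i).natAbs := ?_
    _ = ∑ z ∈ (Finset.Icc 1 k).image (fun j : ℕ => (j : ℤ) - i), mixingCoeff P W z.natAbs := by
        rw [Finset.sum_image]
        intro x _ y _ h
        simpa using h
    _ ≤ _ := hsum.sum_le_tsum _ fun z _ => mixingCoeff_nonneg _
  refine Finset.sum_le_sum fun j _ => ?_
  rw [covariance_eq_sub (hL i) (hL j), integral_indicator_comp hm hA, integral_indicator_comp hm hA]
  have hprod : ((fun ω => A.indicator (fun _ => (1 : ℝ)) (W i ω)) *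
      fun ω => A.indicator (fun _ => (1 : ℝ)) (W j ω)) = (W i ⁻¹' A ∩ W j ⁻¹' A).indicator 1 := by
    ext ω
    by_cases h : W i ω ∈ A <;> by_cases h' : W j ω ∈ A <;> simp [h, h']
  rw [hprod, integral_indicator_one ((hm i hA).inter (hm j hA))]
  exact (le_abs_self _).trans (abs_inter_sub_sq_le_mixingCoeff hs hm hA i j)

lemma measure_le_abs_centredCount (hs : Stationary P W) (hm : ∀ i, Measurable (W i))
    (hsum : Summable fun z : ℤ => mixingCoeff P W z.natAbs) {A : Set (Fin d → ℝ)}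
    (hA : MeasurableSet A) (k : ℕ) {x : ℝ} (hx : 0 < x) :
    P {ω | x ≤ |centredCount P W A k ω|} ≤
      ENNReal.ofReal (k * (∑' z : ℤ, mixingCoeff P W z.natAbs) / x ^ 2) := by
  have hL := memLp_indicator_comp (P := P) hm hA
  have hint : ∫ ω, ∑ i ∈ Finset.Icc 1 k, A.indicator (fun _ => (1 : ℝ)) (W i ω) ∂P =
      k * P.real (W 0 ⁻¹' A) := by
    rw [integral_finsetSum _ fun (i : ℕ) _ => (hL i).integrable (by norm_num)]
    simp_rw [integral_indicator_comp hm hA, hs.measureReal_preimage hm hA]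
    simp
  have hL' : MemLp (fun ω => ∑ i ∈ Finset.Icc 1 k, A.indicator (fun _ => (1 : ℝ)) (W i ω)) 2 P :=
    memLp_finsetSum _ fun i _ => hL i
  have key := meas_ge_le_variance_div_sq hL' hx
  rw [hint] at key
  refine key.trans (ENNReal.ofReal_le_ofReal ?_)
  gcongr
  exact variance_centredCount_le hs hm hsum hA k

/-- Each step adds an indicator minus its mean, a number in `[-1, 1]`. This is what reduces a
maximum over all times to a coarse grid. -/
lemma abs_centredCount_sub_le (A : Set (Fin d → ℝ)) {j k : ℕ} (hjk : j ≤ k) (ω : Ω) :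
    |centredCount P W A k ω - centredCount P W A j ω| ≤ k - j := by
  have hsplit : ∑ i ∈ Finset.Icc 1 k, A.indicator (fun _ => (1 : ℝ)) (W i ω) =
      ∑ i ∈ Finset.Icc 1 j, A.indicator (fun _ => (1 : ℝ)) (W i ω) +
        ∑ i ∈ Finset.Ioc j k, A.indicator (fun _ => (1 : ℝ)) (W i ω) := by
    have := Finset.sum_Ioc_consecutive
      (fun i : ℕ => A.indicator (fun _ => (1 : ℝ)) (W i ω)) (Nat.zero_le j) hjk
    exact this.symm
  have hlo : 0 ≤ ∑ i ∈ Finset.Ioc j k, A.indicator (fun _ => (1 : ℝ)) (W i ω) :=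
    Finset.sum_nonneg fun i _ => Set.indicator_nonneg (fun _ _ => zero_le_one) _
  have hhi : ∑ i ∈ Finset.Ioc j k, A.indicator (fun _ => (1 : ℝ)) (W i ω) ≤ k - j := by
    calc _ ≤ ∑ i ∈ Finset.Ioc j k, (1 : ℝ) :=
          Finset.sum_le_sum fun i _ => Set.indicator_le_self' (fun _ _ => zero_le_one) _
      _ = _ := by simp [Nat.cast_sub hjk]
  have hp1 : P.real (W 0 ⁻¹' A) ≤ 1 := measureReal_le_one
  have hp0 : 0 ≤ P.real (W 0 ⁻¹' A) := measureReal_nonneg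
  have hk : (0 : ℝ) ≤ k - j := sub_nonneg.2 (Nat.cast_le.2 hjk)
  have h1 := mul_nonneg hk hp0
  have h2 := mul_le_mul_of_nonneg_left hp1 hk
  rw [centredCount, centredCount, hsplit, abs_le]
  constructor <;> nlinarith

/-- Weak law of large numbers, uniformly over the initial stretches. -/
theorem tendsto_measure_exists_centredCount (hs : Stationary P W) (hm : ∀ i, Measurable (W i))
    (hsum : Summable fun z : ℤ => mixingCoeff P W z.natAbs) {A : Set (Fin d → ℝ)}
    (hA : MeasurableSet A) {ε : ℝ} (hε : 0 < ε) :
    Tendsto (fun n : ℕ => P {ω | ∃ k ≤ n, ε * n < |centredCount P W A k ω|}) atTop (𝓝 0) := by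
  set C := ∑' z : ℤ, mixingCoeff P W z.natAbs with hC
  have hC0 : 0 ≤ C := tsum_nonneg fun z => mixingCoeff_nonneg _
  obtain ⟨Q, hQ⟩ := exists_nat_gt (4 / ε)
  have hlim : Tendsto (fun n : ℕ => ENNReal.ofReal ((Q + 1) * (C / (ε / 2) ^ 2) * (n : ℝ)⁻¹))
      atTop (𝓝 0) := by
    have h := (tendsto_inv_atTop_nhds_zero_nat (𝕜 := ℝ)).const_mul ((Q + 1) * (C / (ε / 2) ^ 2))
    rw [mul_zero] at h
    simpa using ENNReal.tendsto_ofReal h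
  refine tendsto_of_tendsto_of_tendsto_of_le_of_le' tendsto_const_nhds hlim
    (Eventually.of_forall fun _ => zero_le) ?_
  filter_upwards [eventually_gt_atTop 0, eventually_ge_atTop ⌈4 / ε⌉₊] with n hn0 hn4
  have hn : (0 : ℝ) < n := Nat.cast_pos.2 hn0
  have hεn : 4 ≤ ε * n := by
    have := (Nat.le_ceil (4 / ε)).trans (Nat.cast_le.2 hn4)
    rw [div_le_iff₀ hε] at this
    linarith
  -- The mesh `b` lies between `ε n / 4` and `ε n / 2` (this uses `4 ≤ ε n`): small enough that half
  -- the deviation survives at the preceding grid time, large enough that `Q + 1` grid times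
  -- suffice, with `Q` independent of `n`. Capping grid times at `n` gives every Chebyshev bound the
  -- same form.
  set b : ℕ := ⌊ε * n / 4⌋₊ + 1 with hb
  have hb1 : ε * n / 4 < b := by rw [hb]; push_cast; exact Nat.lt_floor_add_one _
  have hb2 : (b : ℝ) ≤ ε * n / 2 := by
    have := Nat.floor_le (a := ε * n / 4) (by positivity)
    rw [hb]; push_cast; linarith
  have hsub : {ω | ∃ k ≤ n, ε * n < |centredCount P W A k ω|} ⊆
      ⋃ q ∈ Finset.range (Q + 1), {ω | ε / 2 * n ≤ |centredCount P W A (min (b * q) n) ω|} := by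
    rintro ω ⟨k, hk, hω⟩
    simp only [Set.mem_iUnion, Finset.mem_range]
    have hbk : b * (k / b) ≤ k := Nat.mul_div_le k b
    refine ⟨k / b, ?_, ?_⟩
    · have h1 : ((b * (k / b) : ℕ) : ℝ) ≤ n := Nat.cast_le.2 (hbk.trans hk)
      have h2 : ((k / b : ℕ) : ℝ) ≤ Q := by
        by_contra! hcon
        push_cast at h1
        have h3 : ε * n / 4 * (4 / ε) < b * ((k / b : ℕ) : ℝ) :=
          mul_lt_mul'' hb1 (hQ.trans hcon) (by positivity) (by positivity)
        have h4 : ε * n / 4 * (4 / ε) = n := by field_simp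
        linarith
      exact Nat.lt_succ_of_le (Nat.cast_le.1 h2)
    · rw [Set.mem_ofPred_eq, min_eq_left (hbk.trans hk)]
      have h1 := abs_centredCount_sub_le (P := P) (W := W) A hbk ω
      have h2 : (k : ℝ) - (b * (k / b) : ℕ) ≤ b := by
        have h3 : k ≤ b * (k / b) + b := by
          have := Nat.div_add_mod k b
          have := Nat.mod_lt k (show 0 < b from Nat.succ_pos _)
          omega
        have := Nat.cast_le (α := ℝ).2 h3
        push_cast at this ⊢
        linarith
      have h4 := abs_sub_abs_le_abs_sub (centredCount P W A k ω)
        (centredCount P W A (b * (k / b)) ω)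
      have h5 : ε * n < |centredCount P W A k ω| := hω
      linarith
  calc _ ≤ ∑ q ∈ Finset.range (Q + 1), P {ω | ε / 2 * n ≤ |centredCount P W A (min (b * q) n) ω|} :=
        (measure_mono hsub).trans (measure_biUnion_finset_le _ _)
    _ ≤ ∑ q ∈ Finset.range (Q + 1), ENNReal.ofReal (n * C / (ε / 2 * n) ^ 2) := by
        refine Finset.sum_le_sum fun q _ => ?_
        refine (measure_le_abs_centredCount hs hm hsum hA _ (by positivity)).trans
          (ENNReal.ofReal_le_ofReal ?_)
        gcongr
        exact min_le_right _ _
    _ = _ := by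
        rw [Finset.sum_const, Finset.card_range, nsmul_eq_mul, ← ENNReal.ofReal_natCast,
          ← ENNReal.ofReal_mul (by positivity)]
        congr 1
        push_cast
        field_simp

end Mixing


/-! ### Finite brackets for half-lines and orthants. -/

section Brackets

/-- A finite family of brackets of mass at most `ε` for the half-lines. -/
lemma exists_finite_brackets_real (μ : Measure ℝ) [IsProbabilityMeasure μ]
    (hμ : ∀ a, μ {a} = 0) {ε : ℝ} (hε : 0 < ε) :
    ∃ 𝓑 : Set (Set ℝ × Set ℝ), 𝓑.Finite ∧
      (∀ B ∈ 𝓑, MeasurableSet B.1 ∧ MeasurableSet B.2 ∧ μ.real (B.2 \ B.1) ≤ ε) ∧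
      ∀ a, ∃ B ∈ 𝓑, B.1 ⊆ Set.Iic a ∧ Set.Iic a ⊆ B.2 := by
  set g : ℝ → ℝ := fun x => μ.real (Set.Iic x) with hg
  have hgmono : Monotone g := fun x y hxy => measureReal_mono (Set.Iic_subset_Iic.2 hxy)
  have hg1 : ∀ x, g x ≤ 1 := fun x => measureReal_le_one
  have hg0 : ∀ x, 0 ≤ g x := fun x => measureReal_nonneg
  have hmeas : ∀ u, MeasurableSet {x | g x < u} := fun u =>
    measurableSet_lt hgmono.measurable measurable_const
  -- Sublevel sets of the distribution function replace quantiles. A strip need not contain its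
  -- endpoints, so its mass is approximated from inside by a compact set, whose extreme points do
  -- lie in the strip; without atoms, the interval between them has mass equal to the increment of
  -- `g`.
  have hmass : ∀ u v : ℝ, u ≤ v → μ.real ({x | g x < v} \ {x | g x < u}) ≤ v - u := by
    intro u v huv
    have hS : MeasurableSet ({x | g x < v} \ {x | g x < u}) := (hmeas v).diff (hmeas u)
    by_contra! hcon
    have hcon' : ENNReal.ofReal (v - u) < μ ({x | g x < v} \ {x | g x < u}) :=
      (ENNReal.ofReal_lt_iff_lt_toReal (sub_nonneg.2 huv) (measure_ne_top _ _)).2 hcon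
    obtain ⟨K, hKS, hK, hKm⟩ := hS.exists_lt_isCompact_of_ne_top (measure_ne_top _ _) hcon'
    have hne : K.Nonempty := nonempty_of_measure_ne_zero (ne_bot_of_gt hKm)
    have hmin := hKS (hK.sInf_mem hne)
    have hmax := hKS (hK.sSup_mem hne)
    have hle : sInf K ≤ sSup K := csInf_le_csSup hne hK.bddBelow hK.bddAbove
    have hsub : K ⊆ Set.Icc (sInf K) (sSup K) := fun x hx =>
      ⟨csInf_le hK.bddBelow hx, le_csSup hK.bddAbove hx⟩
    have : NullSingletonClass μ := ⟨hμ⟩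
    have h1 : μ.real (Set.Icc (sInf K) (sSup K)) = g (sSup K) - g (sInf K) := by
      rw [measureReal_congr Ioc_ae_eq_Icc.symm, ← Set.Iic_sdiff_Iic,
        measureReal_sdiff (Set.Iic_subset_Iic.2 hle) measurableSet_Iic]
    have h2 : v - u < μ.real K :=
      (ENNReal.ofReal_lt_iff_lt_toReal (sub_nonneg.2 huv) (measure_ne_top _ _)).1 hKm
    have h3 := measureReal_mono (μ := μ) hsub
    have h4 : ¬ g (sInf K) < u := hmin.2
    have h5 : g (sSup K) < v := hmax.1
    linarith
  obtain ⟨N, hN⟩ := exists_nat_gt (1 / ε)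
  have hN0 : (0 : ℝ) < N := (by positivity : (0 : ℝ) < 1 / ε).trans hN
  refine ⟨(fun j : ℕ => ({x | g x < j / N}, {x | g x < (j + 1) / N})) '' Set.Iic N,
    (Set.finite_Iic N).image _, ?_, ?_⟩
  · rintro _ ⟨j, -, rfl⟩
    refine ⟨hmeas _, hmeas _, (hmass _ _ (by gcongr; linarith)).trans ?_⟩
    rw [← sub_div, add_sub_cancel_left]
    rw [div_lt_iff₀ hε] at hN
    rw [div_le_iff₀ hN0]
    linarith
  · intro a
    have hfl : (⌊N * g a⌋₊ : ℝ) ≤ N * g a := Nat.floor_le (mul_nonneg hN0.le (hg0 a))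
    have hfl' : N * g a < ⌊N * g a⌋₊ + 1 := Nat.lt_floor_add_one _
    refine ⟨_, ⟨⌊N * g a⌋₊, ?_, rfl⟩, ?_, ?_⟩
    · have : (⌊N * g a⌋₊ : ℝ) ≤ N := hfl.trans (by nlinarith [hg1 a])
      exact Nat.cast_le.1 this
    · intro x (hx : g x < _)
      rw [lt_div_iff₀ hN0] at hx
      by_contra hxa
      have := hgmono (not_le.1 hxa).le
      nlinarith
    · intro x (hx : x ≤ a)
      rw [Set.mem_ofPred_eq, lt_div_iff₀ hN0]
      have := hgmono hx
      nlinarith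

/-- A finite family of brackets of mass at most `ε` for the lower orthants. -/
lemma exists_finite_brackets_pi {d : ℕ} (μ : Measure (Fin d → ℝ)) [IsProbabilityMeasure μ]
    (hμ : ∀ (k : Fin d) (a : ℝ), μ {x | x k = a} = 0) {ε : ℝ} (hε : 0 < ε) :
    ∃ 𝓑 : Set (Set (Fin d → ℝ) × Set (Fin d → ℝ)), 𝓑.Finite ∧
      (∀ B ∈ 𝓑, MeasurableSet B.1 ∧ MeasurableSet B.2 ∧ μ.real (B.2 \ B.1) ≤ ε) ∧
      ∀ y, ∃ B ∈ 𝓑, B.1 ⊆ Set.Iic y ∧ Set.Iic y ⊆ B.2 := by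
  -- Dividing by `d + 1` instead of `d` also covers `d = 0`.
  have hε' : 0 < ε / (d + 1) := by positivity
  have hcoord : ∀ k : Fin d, Measurable fun x : Fin d → ℝ => x k := fun k => measurable_pi_apply k
  have h1 : ∀ k : Fin d, ∃ 𝓑 : Set (Set ℝ × Set ℝ), 𝓑.Finite ∧
      (∀ B ∈ 𝓑, MeasurableSet B.1 ∧ MeasurableSet B.2 ∧
        (μ.map fun x => x k).real (B.2 \ B.1) ≤ ε / (d + 1)) ∧
      ∀ a, ∃ B ∈ 𝓑, B.1 ⊆ Set.Iic a ∧ Set.Iic a ⊆ B.2 := by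
    intro k
    have := Measure.isProbabilityMeasure_map (μ := μ) (hcoord k).aemeasurable
    refine exists_finite_brackets_real _ (fun a => ?_) hε'
    rw [Measure.map_apply (hcoord k) (measurableSet_singleton a)]
    exact hμ k a
  choose 𝓑 hfin hB hcov using h1
  refine ⟨(fun J : Fin d → Set ℝ × Set ℝ =>
    ({x | ∀ k, x k ∈ (J k).1}, {x | ∀ k, x k ∈ (J k).2})) '' {J | ∀ k, J k ∈ 𝓑 k},
    (Set.Finite.pi' hfin).image _, ?_, ?_⟩
  · rintro _ ⟨J, hJ, rfl⟩
    have hm : ∀ (S : Fin d → Set ℝ), (∀ k, MeasurableSet (S k)) →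
        MeasurableSet {x : Fin d → ℝ | ∀ k, x k ∈ S k} := fun S hS =>
      by
      rw [Set.ofPred_forall]
      exact MeasurableSet.iInter fun k => hcoord k (hS k)
    refine ⟨hm _ fun k => (hB k _ (hJ k)).1, hm _ fun k => (hB k _ (hJ k)).2.1, ?_⟩
    -- A point of the outer product outside the inner one fails the inner condition in some
    -- coordinate, so the gap is covered by `d` strips.
    calc _ ≤ μ.real (⋃ k, (fun x : Fin d → ℝ => x k) ⁻¹' ((J k).2 \ (J k).1)) := by
          refine measureReal_mono ?_
          rintro x ⟨hx2, hx1⟩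
          simp only [Set.mem_ofPred_eq, not_forall] at hx1 hx2
          obtain ⟨k, hk⟩ := hx1
          exact Set.mem_iUnion.2 ⟨k, hx2 k, hk⟩
      _ ≤ ∑ k, μ.real ((fun x : Fin d → ℝ => x k) ⁻¹' ((J k).2 \ (J k).1)) :=
          measureReal_iUnion_fintype_le _
      _ ≤ ∑ k : Fin d, ε / (d + 1) := by
          refine Finset.sum_le_sum fun k _ => ?_
          have := (hB k _ (hJ k)).2.2
          rwa [map_measureReal_apply (hcoord k)
            ((hB k _ (hJ k)).2.1.diff (hB k _ (hJ k)).1)] at this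
      _ ≤ ε := by
          rw [Finset.sum_const, Finset.card_univ, Fintype.card_fin, nsmul_eq_mul,
            mul_div_assoc', div_le_iff₀ (by positivity)]
          nlinarith
  · intro y
    choose J hJ hJ1 hJ2 using fun k => hcov k (y k)
    exact ⟨_, ⟨J, hJ, rfl⟩, fun x hx k => hJ1 k (hx k), fun x hx k => hJ2 k (hx k)⟩

end Brackets

/-! ### Uniformity over lower orthants. -/

section GlivenkoCantelli

variable {Ω : Type*} [MeasurableSpace Ω] {P : Measure Ω} [IsProbabilityMeasure P] {d : ℕ}
  {W : ℤ → Ω → Fin d → ℝ}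

/-- Counts and probabilities are both monotone in the set; replacing the probability of the set by
that of a bracket end costs at most `ε` per observation. -/
lemma abs_centredCount_le_of_bracket (hm : Measurable (W 0)) {L A U : Set (Fin d → ℝ)}
    (hLm : MeasurableSet L) (hLA : L ⊆ A) (hAU : A ⊆ U) {ε : ℝ}
    (hε : P.real (W 0 ⁻¹' (U \ L)) ≤ ε) (k : ℕ) (ω : Ω) :
    |centredCount P W A k ω| ≤
      max |centredCount P W L k ω| |centredCount P W U k ω| + k * ε := by
  rw [Set.preimage_sdiff, measureReal_sdiff (Set.preimage_mono (hLA.trans hAU)) (hm hLm)] at hε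
  have h1 : P.real (W 0 ⁻¹' L) ≤ P.real (W 0 ⁻¹' A) := measureReal_mono (Set.preimage_mono hLA)
  have h2 : P.real (W 0 ⁻¹' A) ≤ P.real (W 0 ⁻¹' U) := measureReal_mono (Set.preimage_mono hAU)
  have hsum : ∀ {S S' : Set (Fin d → ℝ)}, S ⊆ S' →
      ∑ i ∈ Finset.Icc 1 k, S.indicator (fun _ => (1 : ℝ)) (W i ω) ≤
        ∑ i ∈ Finset.Icc 1 k, S'.indicator (fun _ => (1 : ℝ)) (W i ω) := fun h =>
    Finset.sum_le_sum fun i _ => Set.indicator_le_indicator_of_subset h (fun _ => zero_le_one) _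
  have h3 := hsum hLA
  have h4 := hsum hAU
  have hk : (0 : ℝ) ≤ k := Nat.cast_nonneg k
  have h5 := le_max_left |centredCount P W L k ω| |centredCount P W U k ω|
  have h6 := le_max_right |centredCount P W L k ω| |centredCount P W U k ω|
  have h7 := neg_abs_le (centredCount P W L k ω)
  have h8 := le_abs_self (centredCount P W U k ω)
  have h9 : (k : ℝ) * (P.real (W 0 ⁻¹' U) - P.real (W 0 ⁻¹' A)) ≤ k * ε :=
    mul_le_mul_of_nonneg_left (by linarith) hk
  have h10 : (k : ℝ) * (P.real (W 0 ⁻¹' A) - P.real (W 0 ⁻¹' L)) ≤ k * ε :=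
    mul_le_mul_of_nonneg_left (by linarith) hk
  simp only [centredCount] at *
  rw [abs_le]
  constructor <;> linarith

/-- Glivenko–Cantelli theorem in probability, uniform over the initial stretches. -/
theorem tendsto_measure_exists_centredCount_Iic (hs : Stationary P W)
    (hm : ∀ i, Measurable (W i)) (hc : ContinuousVector P (W 0))
    (hsum : Summable fun z : ℤ => mixingCoeff P W z.natAbs) {ε : ℝ} (hε : 0 < ε) :
    Tendsto (fun n : ℕ =>
      P {ω | ∃ k ≤ n, ∃ y, ε * n < |centredCount P W (Set.Iic y) k ω|}) atTop (𝓝 0) := by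
  have := Measure.isProbabilityMeasure_map (μ := P) (hm 0).aemeasurable
  obtain ⟨𝓑, hfin, hB, hcov⟩ := exists_finite_brackets_pi (P.map (W 0)) (fun k a => by
    rw [Measure.map_apply (hm 0) (measurableSet_eq_fun (measurable_pi_apply k) measurable_const)]
    exact hc k a) (half_pos hε)
  have hlim : Tendsto (fun n : ℕ => ∑ B ∈ hfin.toFinset,
      (P {ω | ∃ k ≤ n, ε / 2 * n < |centredCount P W B.1 k ω|} +
        P {ω | ∃ k ≤ n, ε / 2 * n < |centredCount P W B.2 k ω|})) atTop (𝓝 0) := by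
    have h0 : (0 : ENNReal) = ∑ B ∈ hfin.toFinset, 0 := by simp
    rw [h0]
    refine tendsto_finsetSum _ fun B hBm => ?_
    have hBm' := hB B (hfin.mem_toFinset.1 hBm)
    simpa using (tendsto_measure_exists_centredCount hs hm hsum hBm'.1 (half_pos hε)).add
      (tendsto_measure_exists_centredCount hs hm hsum hBm'.2.1 (half_pos hε))
  refine tendsto_of_tendsto_of_tendsto_of_le_of_le tendsto_const_nhds hlim
    (fun _ => zero_le) fun n => ?_
  have hsub : {ω | ∃ k ≤ n, ∃ y, ε * n < |centredCount P W (Set.Iic y) k ω|} ⊆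
      ⋃ B ∈ hfin.toFinset, ({ω | ∃ k ≤ n, ε / 2 * n < |centredCount P W B.1 k ω|} ∪
        {ω | ∃ k ≤ n, ε / 2 * n < |centredCount P W B.2 k ω|}) := by
    rintro ω ⟨k, hk, y, hy⟩
    obtain ⟨B, hBm, hL, hU⟩ := hcov y
    have hBm' := hB B hBm
    rw [map_measureReal_apply (hm 0) (hBm'.2.1.diff hBm'.1)] at hBm'
    have key := abs_centredCount_le_of_bracket (hm 0) hBm'.1 hL hU hBm'.2.2 k ω
    have hkn : (k : ℝ) * (ε / 2) ≤ n * (ε / 2) := by gcongr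
    have hmax : ε / 2 * n < max |centredCount P W B.1 k ω| |centredCount P W B.2 k ω| := by
      linarith
    refine Set.mem_iUnion₂.2 ⟨B, hfin.mem_toFinset.2 hBm, ?_⟩
    rcases lt_max_iff.1 hmax with h | h
    · exact Or.inl ⟨k, hk, h⟩
    · exact Or.inr ⟨k, hk, h⟩
  exact (measure_mono hsub).trans ((measure_biUnion_finset_le _ _).trans
    (Finset.sum_le_sum fun B _ => measure_union_le _ _))

end GlivenkoCantelli


/-! ### Deterministic approximation of the unweighted process. -/

section Deterministic

variable {d : ℕ}

/-- The number of visits of `A` up to time `k`. -/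
noncomputable def visits (x : ℕ → Fin d → ℝ) (A : Set (Fin d → ℝ)) (k : ℕ) : ℝ :=
  ∑ i ∈ Finset.Icc 1 k, A.indicator (fun _ => (1 : ℝ)) (x i)

/-- The centre of the number of visits up to time `k` when the visiting probability changes
from `p` to `q` after time `l`. -/
noncomputable def brokenLine (l : ℕ) (p q : ℝ) (k : ℕ) : ℝ :=
  (min k l : ℕ) * p + ((k : ℝ) - (min k l : ℕ)) * q

/-- The sequential empirical process of `x` is close to its centre, uniformly. -/
def NearCentre (F G : (Fin d → ℝ) → ℝ) (c τ η : ℝ) (m : ℕ) (x : ℕ → Fin d → ℝ) : Prop :=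
  ∀ k ≤ ⌊(m : ℝ) * τ⌋₊, ∀ y,
    |visits x (Set.Iic y) k - brokenLine ⌊(m : ℝ) * c⌋₊ (F y) (G y) k| ≤ η * m

lemma visits_sub_visits (x : ℕ → Fin d → ℝ) (A : Set (Fin d → ℝ)) {j k : ℕ} (hjk : j ≤ k) :
    visits x A k - visits x A j = ∑ i ∈ Finset.Icc (j + 1) k, A.indicator (fun _ => (1 : ℝ)) (x i) := by
  have h := Finset.sum_Ioc_consecutive
    (fun i : ℕ => A.indicator (fun _ => (1 : ℝ)) (x i)) (Nat.zero_le j) hjk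
  have hIcc : Finset.Icc (j + 1) k = Finset.Ioc j k := by ext i; simp
  rw [sub_eq_iff_eq_add', hIcc]
  exact h.symm

/-- Multiplying by the length makes the zero convention for an empty stretch harmless. -/
lemma mul_empDF (x : ℕ → Fin d → ℝ) {j k : ℕ} (hjk : j ≤ k) (y : Fin d → ℝ) :
    ((k : ℝ) - j) * empDF x (j + 1) k y = visits x (Set.Iic y) k - visits x (Set.Iic y) j := by
  rw [visits_sub_visits x _ hjk, empDF]
  have hsum : ∑ i ∈ Finset.Icc (j + 1) k, {z | x i ≤ z}.indicator (fun _ => (1 : ℝ)) y =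
      ∑ i ∈ Finset.Icc (j + 1) k, (Set.Iic y).indicator (fun _ => (1 : ℝ)) (x i) :=
    Finset.sum_congr rfl fun i _ => by by_cases h : x i ≤ y <;> simp [h]
  rw [hsum]
  split_ifs with h
  · have hjk' : (j : ℝ) < k := Nat.cast_lt.2 h
    have h0 : (k : ℝ) - j ≠ 0 := (sub_pos.2 hjk').ne'
    have h1 : (k : ℝ) - (j + 1 : ℕ) + 1 = k - j := by push_cast; ring
    rw [h1]
    field_simp
  · rw [Finset.Icc_eq_empty h]
    simp

lemma mul_empDF_one (x : ℕ → Fin d → ℝ) (k : ℕ) (y : Fin d → ℝ) :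
    (k : ℝ) * empDF x 1 k y = visits x (Set.Iic y) k := by
  have h := mul_empDF x (Nat.zero_le k) y
  simpa [visits] using h

lemma empDF_nonneg (x : ℕ → Fin d → ℝ) (j k : ℕ) (y : Fin d → ℝ) : 0 ≤ empDF x j k y := by
  rw [empDF]
  split_ifs with h
  · have : (j : ℝ) ≤ k := Nat.cast_le.2 h
    refine mul_nonneg (div_nonneg zero_le_one (by linarith)) (Finset.sum_nonneg fun i _ => ?_)
    exact Set.indicator_nonneg (fun _ _ => zero_le_one) _
  · exact le_rfl

lemma empDF_le_one (x : ℕ → Fin d → ℝ) (j k : ℕ) (y : Fin d → ℝ) : empDF x j k y ≤ 1 := by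
  rw [empDF]
  split_ifs with h
  · have hjk : (j : ℝ) ≤ k := Nat.cast_le.2 h
    rw [one_div_mul_eq_div, div_le_one (by linarith)]
    calc _ ≤ ∑ i ∈ Finset.Icc j k, (1 : ℝ) :=
          Finset.sum_le_sum fun i _ => Set.indicator_le_self' (fun _ _ => zero_le_one) _
      _ = _ := by
          rw [Finset.sum_const, Nat.card_Icc, nsmul_one, Nat.cast_sub (by omega)]
          push_cast; ring
  · exact zero_le_one

lemma abs_empDF_sub_le_one (x : ℕ → Fin d → ℝ) (j k j' k' : ℕ) (y : Fin d → ℝ) :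
    |empDF x j k y - empDF x j' k' y| ≤ 1 := by
  have h1 := empDF_nonneg x j k y
  have h2 := empDF_nonneg x j' k' y
  have h3 := empDF_le_one x j k y
  have h4 := empDF_le_one x j' k' y
  rw [abs_le]
  constructor <;> linarith

lemma lam_zero (m : ℕ) (s : ℝ) : lam m 0 s = (⌊(m : ℝ) * s⌋₊ : ℝ) / m := by simp [lam]

lemma lam_nonneg (m : ℕ) {s t : ℝ} (hst : s ≤ t) : 0 ≤ lam m s t := by
  have : ⌊(m : ℝ) * s⌋₊ ≤ ⌊(m : ℝ) * t⌋₊ := Nat.floor_mono (by gcongr)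
  have : (⌊(m : ℝ) * s⌋₊ : ℝ) ≤ ⌊(m : ℝ) * t⌋₊ := Nat.cast_le.2 this
  exact div_nonneg (by linarith) (Nat.cast_nonneg m)

lemma floor_div_le (m : ℕ) {t : ℝ} (ht : 0 ≤ t) : (⌊(m : ℝ) * t⌋₊ : ℝ) / m ≤ t :=
  div_le_of_le_mul₀ (Nat.cast_nonneg m) ht
    ((Nat.floor_le (by positivity)).trans_eq (mul_comm _ _))

lemma sub_le_floor_div {m : ℕ} (hm : 0 < m) (t : ℝ) :
    t - 1 / m ≤ (⌊(m : ℝ) * t⌋₊ : ℝ) / m := by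
  have hm' : (0 : ℝ) < m := Nat.cast_pos.2 hm
  rw [le_div_iff₀ hm', sub_mul, one_div_mul_cancel hm'.ne']
  have := Nat.lt_floor_add_one ((m : ℝ) * t)
  linarith

lemma lam_le (m : ℕ) {s t : ℝ} (ht : 0 ≤ t) : lam m s t ≤ t := by
  refine le_trans ?_ (floor_div_le m ht)
  rw [lam]
  gcongr
  simp

lemma inv_sqrt_mul_procH {m : ℕ} (hm : 0 < m) (x : ℕ → Fin d → ℝ) {s t : ℝ} (hst : s ≤ t)
    (y : Fin d → ℝ) :
    (√(m : ℝ))⁻¹ * procH m x s t y =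
      lam m s t * (visits x (Set.Iic y) ⌊(m : ℝ) * s⌋₊ / m) -
        lam m 0 s * ((visits x (Set.Iic y) ⌊(m : ℝ) * t⌋₊ -
          visits x (Set.Iic y) ⌊(m : ℝ) * s⌋₊) / m) := by
  have hm' : (0 : ℝ) < m := Nat.cast_pos.2 hm
  have hle : ⌊(m : ℝ) * s⌋₊ ≤ ⌊(m : ℝ) * t⌋₊ := Nat.floor_mono (by gcongr)
  have hsq : √(m : ℝ) ≠ 0 := (Real.sqrt_pos.2 hm').ne'
  rw [← mul_empDF x hle, ← mul_empDF_one, procH, lam_zero, lam]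
  field_simp

lemma abs_inv_sqrt_mul_procH_le (m : ℕ) (x : ℕ → Fin d → ℝ) {s t τ : ℝ} (hs : 0 ≤ s) (hst : s ≤ t)
    (htτ : t ≤ τ) (y : Fin d → ℝ) : |(√(m : ℝ))⁻¹ * procH m x s t y| ≤ τ * τ := by
  have h0 := lam_nonneg m hs
  have h1 := (lam_le m (s := 0) hs).trans (hst.trans htτ)
  have h2 := lam_nonneg m hst
  have h3 := (lam_le m (s := s) (hs.trans hst)).trans htτ
  -- An inequality rather than an equality, because the product is `0` at `m = 0`.
  have h4 : (√(m : ℝ))⁻¹ * √(m : ℝ) ≤ 1 := inv_mul_le_one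
  have h5 : 0 ≤ (√(m : ℝ))⁻¹ * √(m : ℝ) := by positivity
  have hτ : 0 ≤ τ := h0.trans h1
  have e : (√(m : ℝ))⁻¹ * procH m x s t y = ((√(m : ℝ))⁻¹ * √(m : ℝ)) * (lam m 0 s * lam m s t *
      (empDF x 1 ⌊(m : ℝ) * s⌋₊ y - empDF x (⌊(m : ℝ) * s⌋₊ + 1) ⌊(m : ℝ) * t⌋₊ y)) := by
    rw [procH]; ring
  rw [e, abs_mul, abs_of_nonneg h5, abs_mul, abs_of_nonneg (mul_nonneg h0 h2)]
  calc _ ≤ 1 * (τ * τ * 1) := by gcongr; exact abs_empDF_sub_le_one _ _ _ _ _ _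
    _ = _ := by ring

lemma abs_limK_le {c τ : ℝ} (hc0 : 0 ≤ c) (hcτ : c ≤ τ) {F G : (Fin d → ℝ) → ℝ} {y : Fin d → ℝ}
    (hFG : |F y - G y| ≤ 1) {s t : ℝ} (hs : 0 ≤ s) (hst : s ≤ t) (htτ : t ≤ τ) :
    |limK c F G s t y| ≤ τ * τ := by
  have h1 : 0 ≤ min s c := le_min hs hc0
  have h2 : min s c ≤ τ := (min_le_right _ _).trans hcτ
  have h3 : 0 ≤ max t c - max s c := sub_nonneg.2 (max_le_max_right c hst)
  have h4 : max t c - max s c ≤ τ := by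
    have := max_le htτ hcτ
    have := hc0.trans (le_max_right s c)
    linarith
  have hτ : 0 ≤ τ := h1.trans h2
  rw [limK, abs_mul, abs_mul, abs_of_nonneg h1, abs_of_nonneg h3]
  calc _ ≤ τ * τ * 1 := by gcongr
    _ = _ := by ring

lemma abs_mul_sub_mul_le {p q p' q' τ e : ℝ} (hq : |q| ≤ τ) (hp' : |p'| ≤ τ) (h : |p - p'| ≤ e)
    (h' : |q - q'| ≤ e) : |p * q - p' * q'| ≤ 2 * τ * e := by
  have h1 : p * q - p' * q' = (p - p') * q + p' * (q - q') := by ring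
  have h2 : |(p - p') * q| ≤ e * τ := by
    rw [abs_mul]; exact mul_le_mul h hq (abs_nonneg _) ((abs_nonneg _).trans h)
  have h3 : |p' * (q - q')| ≤ τ * e := by
    rw [abs_mul]; exact mul_le_mul hp' h' (abs_nonneg _) ((abs_nonneg _).trans hp')
  rw [h1]
  linarith [abs_add_le ((p - p') * q) (p' * (q - q'))]

lemma abs_procH_sub_limK_le {m : ℕ} (hm : 0 < m) {c τ η : ℝ} (hc0 : 0 ≤ c) (hcτ : c ≤ τ)
    {F G : (Fin d → ℝ) → ℝ} (hFG : ∀ y, |F y - G y| ≤ 1) {x : ℕ → Fin d → ℝ}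
    (hx : NearCentre F G c τ η m x) {s t : ℝ} (hs : 0 ≤ s) (hst : s ≤ t) (htτ : t ≤ τ)
    (y : Fin d → ℝ) :
    |(√(m : ℝ))⁻¹ * procH m x s t y - limK c F G s t y| ≤ 3 * τ * (η + 1 / m) := by
  have hm' : (0 : ℝ) < m := Nat.cast_pos.2 hm
  have hab : ⌊(m : ℝ) * s⌋₊ ≤ ⌊(m : ℝ) * t⌋₊ := Nat.floor_mono (by gcongr)
  have hxs := hx ⌊(m : ℝ) * s⌋₊ (Nat.floor_mono (by gcongr; linarith)) y
  have hxt := hx ⌊(m : ℝ) * t⌋₊ (Nat.floor_mono (by gcongr)) y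
  have hS0 := floor_div_le m hs
  have hS1 := sub_le_floor_div hm s
  have hT0 := floor_div_le m (hs.trans hst)
  have hT1 := sub_le_floor_div hm t
  have hC0 := floor_div_le m hc0
  have hC1 := sub_le_floor_div hm c
  have hl1 := lam_nonneg m hs
  have hl2 := (lam_le m (s := 0) hs).trans (hst.trans htτ)
  have hl3 := lam_nonneg m hst
  have hl4 := (lam_le m (s := s) (hs.trans hst)).trans htτ
  rw [inv_sqrt_mul_procH hm x hst]
  have hlam : lam m s t = (⌊(m : ℝ) * t⌋₊ : ℝ) / m - (⌊(m : ℝ) * s⌋₊ : ℝ) / m := by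
    rw [lam, sub_div]
  have hlam0 := lam_zero m s
  have hS2 : (0 : ℝ) ≤ (⌊(m : ℝ) * s⌋₊ : ℝ) / m := by positivity
  have hC2 : (0 : ℝ) ≤ (⌊(m : ℝ) * c⌋₊ : ℝ) / m := by positivity
  have hST : (⌊(m : ℝ) * s⌋₊ : ℝ) / m ≤ (⌊(m : ℝ) * t⌋₊ : ℝ) / m := by gcongr
  have hb : ∀ k : ℕ, brokenLine ⌊(m : ℝ) * c⌋₊ (F y) (G y) k / m =
      min ((k : ℝ) / m) ((⌊(m : ℝ) * c⌋₊ : ℝ) / m) * F y +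
        ((k : ℝ) / m - min ((k : ℝ) / m) ((⌊(m : ℝ) * c⌋₊ : ℝ) / m)) * G y := by
    intro k
    rw [brokenLine, min_div_div_right hm'.le, Nat.cast_min]
    ring
  have hxs' : |visits x (Set.Iic y) ⌊(m : ℝ) * s⌋₊ / m -
      brokenLine ⌊(m : ℝ) * c⌋₊ (F y) (G y) ⌊(m : ℝ) * s⌋₊ / m| ≤ η := by
    rwa [← sub_div, abs_div, abs_of_pos hm', div_le_iff₀ hm']
  have hxt' : |visits x (Set.Iic y) ⌊(m : ℝ) * t⌋₊ / m -
      brokenLine ⌊(m : ℝ) * c⌋₊ (F y) (G y) ⌊(m : ℝ) * t⌋₊ / m| ≤ η := by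
    rwa [← sub_div, abs_div, abs_of_pos hm', div_le_iff₀ hm']
  rw [hb] at hxs' hxt'
  rw [sub_div]
  set A := (⌊(m : ℝ) * s⌋₊ : ℝ) / m
  set B := (⌊(m : ℝ) * t⌋₊ : ℝ) / m
  set C := (⌊(m : ℝ) * c⌋₊ : ℝ) / m
  set U := visits x (Set.Iic y) ⌊(m : ℝ) * s⌋₊ / m
  set V := visits x (Set.Iic y) ⌊(m : ℝ) * t⌋₊ / m
  set e : ℝ := 1 / m
  have he : 0 < e := by positivity
  have hτ : 0 ≤ τ := hc0.trans hcτ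
  -- Two stochastic terms, linear in the deviations of the counts, plus a rounding term in which
  -- only `s`, `t` and `c` have been replaced by their discretisations.
  have hident : lam m s t * U - lam m 0 s * (V - U) - limK c F G s t y =
      lam m s t * (U - (min A C * F y + (A - min A C) * G y)) -
        lam m 0 s * ((V - (min B C * F y + (B - min B C) * G y)) -
          (U - (min A C * F y + (A - min A C) * G y))) +
      (min A C * (max B C - max A C) - min s c * (max t c - max s c)) * (F y - G y) := by
    have hdisc : (B - A) * min A C - A * (min B C - min A C) = min A C * (max B C - max A C) := by
      rcases le_total A C with h1 | h1 <;> rcases le_total B C with h2 | h2 <;>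
        simp only [min_eq_left, min_eq_right, max_eq_left, max_eq_right, h1, h2] <;>
        first | ring1 | skip
      -- The case left over has `C ≤ A` and `B ≤ C`; with `A ≤ B` all three coincide.
      have : A = C := by linarith
      have : B = C := by linarith
      simp_all
    rw [limK, ← hdisc, hlam, hlam0]
    ring
  have h1 : |lam m s t * (U - (min A C * F y + (A - min A C) * G y))| ≤ τ * η := by
    rw [abs_mul, abs_of_nonneg hl3]
    gcongr
  have h2 : |lam m 0 s * ((V - (min B C * F y + (B - min B C) * G y)) -
          (U - (min A C * F y + (A - min A C) * G y)))| ≤ τ * (η + η) := by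
    rw [abs_mul, abs_of_nonneg hl1]
    gcongr
    exact (abs_sub _ _).trans (add_le_add hxt' hxs')
  have h3 : |(min A C * (max B C - max A C) - min s c * (max t c - max s c)) * (F y - G y)| ≤
      2 * τ * e * 1 := by
    rw [abs_mul]
    refine mul_le_mul ?_ (hFG y) (abs_nonneg _) (by positivity)
    have hm1 : |min A C - min s c| ≤ e := by
      refine (abs_min_sub_min_le_max _ _ _ _).trans (max_le ?_ ?_) <;> rw [abs_le] <;>
        constructor <;> linarith
    refine abs_mul_sub_mul_le ?_ ?_ hm1 ?_
    · rw [abs_le]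
      have := le_max_right A C
      have := max_le_max_right C hST
      have := max_le (hT0.trans htτ) (hC0.trans hcτ)
      constructor <;> linarith
    · rw [abs_of_nonneg (le_min hs hc0)]
      exact (min_le_right _ _).trans hcτ
    · have k1 : max B C ≤ max t c := max_le_max hT0 hC0
      have k2 : max A C ≤ max s c := max_le_max hS0 hC0
      have k3 : max t c ≤ max B C + e :=
        max_le (by linarith [le_max_left B C]) (by linarith [le_max_right B C])
      have k4 : max s c ≤ max A C + e :=
        max_le (by linarith [le_max_left A C]) (by linarith [le_max_right A C])
      rw [abs_le]
      constructor <;> linarith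
  rw [hident]
  refine (abs_add_le _ _).trans ((add_le_add ((abs_sub _ _).trans (add_le_add h1 h2)) h3).trans ?_)
  nlinarith [mul_nonneg hτ he.le]

end Deterministic


/-! ### The weight function and the weighted process. -/

section Weights

variable {d : ℕ}

lemma le_weightQ (γ δ s t : ℝ) : δ ≤ weightQ γ δ s t := le_max_right _ _

/-- A real power with nonnegative exponent is continuous on all of `ℝ`, negative bases included, so
no restriction to `s ≤ t` is needed and compactness can be used on a whole square. -/
lemma continuous_weightQ {γ : ℝ} (hγ : 0 ≤ γ) (δ : ℝ) :
    Continuous fun p : ℝ × ℝ => weightQ γ δ p.1 p.2 := by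
  have h := Real.continuous_rpow_const hγ
  exact ((h.comp continuous_fst).mul (h.comp (continuous_snd.sub continuous_fst))).max
    continuous_const

lemma exists_weightQ_close {γ : ℝ} (hγ : 0 ≤ γ) (δ τ : ℝ) {ε : ℝ} (hε : 0 < ε) :
    ∃ ρ > 0, ∀ s ∈ Set.Icc 0 τ, ∀ t ∈ Set.Icc 0 τ, ∀ s' ∈ Set.Icc 0 τ, ∀ t' ∈ Set.Icc 0 τ,
      |s' - s| < ρ → |t' - t| < ρ → |weightQ γ δ s' t' - weightQ γ δ s t| < ε := by
  have hK : IsCompact (Set.Icc (0 : ℝ) τ ×ˢ Set.Icc (0 : ℝ) τ) := isCompact_Icc.prod isCompact_Icc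
  have hu := hK.uniformContinuousOn_of_continuous (continuous_weightQ hγ δ).continuousOn
  obtain ⟨ρ, hρ, h⟩ := Metric.uniformContinuousOn_iff.1 hu ε hε
  refine ⟨ρ, hρ, fun s hs t ht s' hs' t' ht' h1 h2 => ?_⟩
  exact h (s', t') ⟨hs', ht'⟩ (s, t) ⟨hs, ht⟩ (max_lt h1 h2)

lemma exists_weightQ_le {γ : ℝ} (hγ : 0 ≤ γ) (δ τ : ℝ) :
    ∃ Q, ∀ s ∈ Set.Icc 0 τ, ∀ t ∈ Set.Icc 0 τ, weightQ γ δ s t ≤ Q := by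
  have hK : IsCompact (Set.Icc (0 : ℝ) τ ×ˢ Set.Icc (0 : ℝ) τ) := isCompact_Icc.prod isCompact_Icc
  obtain ⟨Q, hQ⟩ := hK.bddAbove_image (continuous_weightQ hγ δ).continuousOn
  exact ⟨Q, fun s hs t ht => hQ ⟨(s, t), ⟨hs, ht⟩, rfl⟩⟩

lemma abs_div_sub_div_le {A B q r δ κ e₁ e₂ : ℝ} (hδ : 0 < δ) (hq : δ ≤ q) (hr : δ ≤ r)
    (hB : |B| ≤ κ) (h₁ : |A - B| ≤ e₁) (h₂ : |q - r| ≤ e₂) :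
    |A / q - B / r| ≤ e₁ / δ + κ * e₂ / (δ * δ) := by
  have hq0 := hδ.trans_le hq
  have hr0 := hδ.trans_le hr
  have h : A / q - B / r = (A - B) / q + B * (r - q) / (q * r) := by
    field_simp
    ring
  rw [h]
  have h1 : |(A - B) / q| ≤ e₁ / δ := by
    rw [abs_div, abs_of_pos hq0]
    exact div_le_div₀ ((abs_nonneg _).trans h₁) h₁ hδ hq
  have h2 : |B * (r - q) / (q * r)| ≤ κ * e₂ / (δ * δ) := by
    rw [abs_div, abs_mul, abs_of_pos (mul_pos hq0 hr0), abs_sub_comm r q]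
    have hκ := (abs_nonneg _).trans hB
    exact div_le_div₀ (mul_nonneg hκ ((abs_nonneg _).trans h₂))
      (mul_le_mul hB h₂ (abs_nonneg _) hκ) (by positivity) (by gcongr)
  exact (abs_add_le _ _).trans (add_le_add h1 h2)

/-- If the sequential empirical process is close to its centre, then the weighted process is
close to its limit. -/
lemma exists_procHq_close {γ δ c τ : ℝ} (hγ : 0 ≤ γ) (hδ : 0 < δ) (hc0 : 0 ≤ c) (hcτ : c ≤ τ)
    {F G : (Fin d → ℝ) → ℝ} (hFG : ∀ y, |F y - G y| ≤ 1) {ε : ℝ} (hε : 0 < ε) :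
    ∃ η > 0, ∃ M : ℕ, ∀ m ≥ M, 0 < m ∧ ∀ x : ℕ → Fin d → ℝ, NearCentre F G c τ η m x →
      ∀ s t : ℝ, 0 ≤ s → s ≤ t → t ≤ τ → ∀ y,
        |(√(m : ℝ))⁻¹ * procH m x s t y - limK c F G s t y| ≤ ε ∧
        |(√(m : ℝ))⁻¹ * procHq γ δ m x s t y - limK c F G s t y / weightQ γ δ s t| ≤ ε := by
  have hτ : 0 ≤ τ := hc0.trans hcτ
  obtain ⟨e₁, he₁, he₁ε, he₁'⟩ : ∃ e > 0, e ≤ ε ∧ e / δ ≤ ε / 2 :=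
    ⟨min ε (ε / 2 * δ), by positivity, min_le_left _ _, by
      rw [div_le_iff₀ hδ]; exact min_le_right _ _⟩
  obtain ⟨e₂, he₂, he₂'⟩ : ∃ e > 0, τ * τ * e / (δ * δ) ≤ ε / 2 := by
    refine ⟨ε / 2 * (δ * δ) / (τ * τ + 1), by positivity, ?_⟩
    rw [div_le_iff₀ (by positivity), mul_div_assoc', div_le_iff₀ (by positivity)]
    nlinarith [(by positivity : 0 < ε / 2 * (δ * δ))]
  obtain ⟨ρ, hρ, hq⟩ := exists_weightQ_close hγ δ τ he₂
  -- Once `1 / m ≤ η`, the unweighted error is at most `3 τ · 2 η ≤ e₁`.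
  set η := e₁ / (6 * τ + 1) with hη
  have hη0 : 0 < η := by positivity
  obtain ⟨M, hM⟩ := exists_nat_gt (max (1 / η) (1 / ρ))
  refine ⟨η, hη0, M, fun m hm => ?_⟩
  have hmM : max (1 / η) (1 / ρ) < m := hM.trans_le (Nat.cast_le.2 hm)
  have hm0 : (0 : ℝ) < m := (by positivity : (0 : ℝ) < max (1 / η) (1 / ρ)).trans hmM
  have hmη : 1 / (m : ℝ) ≤ η := by
    rw [one_div_le hm0 hη0]; exact (le_max_left _ _).trans hmM.le
  have hmρ : 1 / (m : ℝ) < ρ := by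
    rw [one_div_lt hm0 hρ]; exact (le_max_right _ _).trans_lt hmM
  have hm' : 0 < m := Nat.cast_pos.1 hm0
  refine ⟨hm', fun x hx s t hs hst htτ y => ?_⟩
  have h1 : |(√(m : ℝ))⁻¹ * procH m x s t y - limK c F G s t y| ≤ e₁ := by
    refine (abs_procH_sub_limK_le hm' hc0 hcτ hFG hx hs hst htτ y).trans ?_
    calc 3 * τ * (η + 1 / m) ≤ 3 * τ * (η + η) := by gcongr
      _ = 6 * τ * e₁ / (6 * τ + 1) := by rw [hη]; ring
      _ ≤ e₁ := by
        rw [div_le_iff₀ (by positivity)]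
        nlinarith
  refine ⟨h1.trans he₁ε, ?_⟩
  have hs' := floor_div_le m hs
  have ht' := floor_div_le m (hs.trans hst)
  have h2 : |weightQ γ δ (lam m 0 s) (lam m 0 t) - weightQ γ δ s t| ≤ e₂ := by
    have h3 := sub_le_floor_div hm' s
    have h4 := sub_le_floor_div hm' t
    rw [← lam_zero] at hs' ht' h3 h4
    refine (hq s ⟨hs, hst.trans htτ⟩ t ⟨hs.trans hst, htτ⟩ _
      ⟨lam_nonneg m hs, hs'.trans (hst.trans htτ)⟩ _
      ⟨lam_nonneg m (hs.trans hst), ht'.trans htτ⟩ ?_ ?_).le <;>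
    · rw [abs_lt]
      constructor <;> linarith
  rw [procHq, ← mul_div_assoc]
  refine (abs_div_sub_div_le hδ (le_weightQ _ _ _ _) (le_weightQ _ _ _ _)
    (abs_limK_le hc0 hcτ (hFG y) hs hst htτ) h1 h2).trans ?_
  linarith

end Weights

/-! ### Detectors in terms of the weighted process. -/

section Detectors

variable {d : ℕ}

lemma procHq_eq_wdiff (γ δ : ℝ) {m : ℕ} (hm : 0 < m) (x : ℕ → Fin d → ℝ) (s t : ℝ)
    (y : Fin d → ℝ) :
    procHq γ δ m x s t y = wdiff γ δ m x ⌊(m : ℝ) * s⌋₊ ⌊(m : ℝ) * t⌋₊ y := by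
  have hm' : (0 : ℝ) < m := Nat.cast_pos.2 hm
  have h32 : (m : ℝ) ^ (3 / 2 : ℝ) = m * √(m : ℝ) := by
    rw [Real.sqrt_eq_rpow, ← Real.rpow_one_add' hm'.le (by norm_num)]
    norm_num
  have hsq : √(m : ℝ) ≠ 0 := (Real.sqrt_pos.2 hm').ne'
  have hsq2 : √(m : ℝ) * √(m : ℝ) = m := Real.mul_self_sqrt hm'.le
  rw [procHq, procH, wdiff, h32, lam_zero, lam_zero, lam]
  have h : √(m : ℝ) * ((⌊(m : ℝ) * s⌋₊ : ℝ) / m) * (((⌊(m : ℝ) * t⌋₊ : ℝ) - ⌊(m : ℝ) * s⌋₊) / m) =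
      ⌊(m : ℝ) * s⌋₊ * ((⌊(m : ℝ) * t⌋₊ : ℝ) - ⌊(m : ℝ) * s⌋₊) / (m * √(m : ℝ)) := by
    field_simp
    rw [pow_two, hsq2]
  rw [h, ← div_div]
  ring

lemma wdiff_eq_procHq (γ δ : ℝ) {m : ℕ} (hm : 0 < m) (x : ℕ → Fin d → ℝ) (j : ℕ) (t : ℝ)
    (y : Fin d → ℝ) :
    wdiff γ δ m x j ⌊(m : ℝ) * t⌋₊ y = procHq γ δ m x ((j : ℝ) / m) t y := by
  rw [procHq_eq_wdiff γ δ hm, mul_div_cancel₀ _ (Nat.cast_pos.2 hm).ne', Nat.floor_natCast]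

lemma abs_wdiff_le (γ δ : ℝ) (m : ℕ) (x : ℕ → Fin d → ℝ) (j k : ℕ) (y : Fin d → ℝ) :
    |wdiff γ δ m x j k y| ≤
      |(j * ((k : ℝ) - j)) / ((m : ℝ) ^ (3 / 2 : ℝ) * weightQ γ δ (j / m) (k / m))| := by
  rw [wdiff, abs_mul]
  exact mul_le_of_le_one_right (abs_nonneg _) (abs_empDF_sub_le_one _ _ _ _ _ _)

/-- Only finitely many indices occur, so the real supremum is over a bounded family and does not
fall back to its default value. -/
lemma le_supDet {T : ℝ} (m : ℕ) (D : ℕ → ℝ) {t : ℝ} (ht : t ∈ Set.Icc 1 (T + 1)) :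
    D ⌊(m : ℝ) * t⌋₊ ≤ supDet T m D := by
  refine le_ciSup (f := fun t : Set.Icc (1 : ℝ) (T + 1) => D ⌊(m : ℝ) * t⌋₊) ?_ ⟨t, ht⟩
  refine (((Set.finite_Iic ⌊(m : ℝ) * (T + 1)⌋₊).image D).subset ?_).bddAbove
  rintro _ ⟨u, rfl⟩
  refine ⟨_, Nat.floor_mono ?_, rfl⟩
  have := u.2.2
  gcongr

lemma abs_wdiff_le_detR (γ δ : ℝ) {m : ℕ} (x : ℕ → Fin d → ℝ) {j k : ℕ} (hj : j ∈ Set.Ico m k)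
    (y : Fin d → ℝ) : |wdiff γ δ m x j k y| ≤ detR γ δ m x k := by
  refine le_trans ?_ (le_ciSup (f := fun j : Set.Ico m k => ⨆ y, |wdiff γ δ m x j k y|)
    (Set.finite_range _).bddAbove ⟨j, hj⟩)
  exact le_ciSup (f := fun y => |wdiff γ δ m x j k y|)
    ⟨_, Set.forall_mem_range.2 fun y => abs_wdiff_le γ δ m x j k y⟩ y

/-- At most `T m` change points are summed with factor `1 / m`. Hence divergence of the second
Cramér–von Mises detector forces that of the first. -/
lemma detT_le_mul_detS {T : ℝ} (hT : 0 ≤ T) (γ δ : ℝ) (m : ℕ) (x : ℕ → Fin d → ℝ) :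
    detT γ δ m x ⌊(m : ℝ) * (T + 1)⌋₊ ≤ T * detS γ δ m x ⌊(m : ℝ) * (T + 1)⌋₊ := by
  set k := ⌊(m : ℝ) * (T + 1)⌋₊ with hk
  have hnn : ∀ j, 0 ≤ (1 / (k : ℝ)) * ∑ i ∈ Finset.Icc 1 k, (wdiff γ δ m x j k (x i)) ^ 2 :=
    fun j => mul_nonneg (by positivity) (Finset.sum_nonneg fun i _ => sq_nonneg _)
  have hS : 0 ≤ detS γ δ m x k := Real.iSup_nonneg fun j => hnn j
  have hle : ∀ j ∈ Finset.Ico m k, (1 / (k : ℝ)) * ∑ i ∈ Finset.Icc 1 k,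
      (wdiff γ δ m x j k (x i)) ^ 2 ≤ detS γ δ m x k := fun j hj =>
    le_ciSup (f := fun j : Set.Ico m k => (1 / (k : ℝ)) * ∑ i ∈ Finset.Icc 1 k,
      (wdiff γ δ m x j k (x i)) ^ 2) (Set.finite_range _).bddAbove ⟨j, by simpa using hj⟩
  have hmk : m ≤ k := Nat.le_floor (le_mul_of_one_le_right (Nat.cast_nonneg m) (by linarith))
  have hkm : (k : ℝ) - m ≤ T * m := by
    have := Nat.floor_le (a := (m : ℝ) * (T + 1)) (by positivity)
    rw [← hk] at this
    linarith
  rw [detT]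
  calc _ ≤ (1 / (m : ℝ)) * ∑ j ∈ Finset.Ico m k, detS γ δ m x k := by
        gcongr with j hj
        exact hle j hj
    _ = (1 / (m : ℝ)) * ((k - m) * detS γ δ m x k) := by
        rw [Finset.sum_const, Nat.card_Ico, nsmul_eq_mul, Nat.cast_sub hmk]
    _ ≤ (1 / (m : ℝ)) * (T * m * detS γ δ m x k) := by gcongr
    _ = (m / m : ℝ) * (T * detS γ δ m x k) := by ring
    _ ≤ _ := mul_le_of_le_one_left (mul_nonneg hT hS) (div_self_le_one _)

/-- Lower bound for the second Cramér–von Mises type detector: if the weighted difference is at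
least `κ` on `A` for all change points in `J`. -/
lemma le_detT (γ δ : ℝ) {m k : ℕ} (x : ℕ → Fin d → ℝ) {J : Finset ℕ}
    (hJ : J ⊆ Finset.Ico m k) (A : Set (Fin d → ℝ)) {κ : ℝ}
    (h : ∀ j ∈ J, ∀ y ∈ A, κ ≤ wdiff γ δ m x j k y ^ 2) :
    (1 / (m : ℝ)) * (J.card * ((1 / (k : ℝ)) * (κ * visits x A k))) ≤ detT γ δ m x k := by
  rw [detT]
  gcongr
  rw [← nsmul_eq_mul, ← Finset.sum_const]
  refine (Finset.sum_le_sum fun j hj => ?_).trans (Finset.sum_le_sum_of_subset_of_nonneg hJ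
    fun j _ _ => mul_nonneg (by positivity) (Finset.sum_nonneg fun i _ => sq_nonneg _))
  gcongr
  rw [visits, Finset.mul_sum]
  refine Finset.sum_le_sum fun i _ => ?_
  by_cases hi : x i ∈ A
  · simpa [hi] using h j hj _ hi
  · simpa [hi] using sq_nonneg _

end Detectors


/-! ### The sequence with a change point: process limits and divergence. -/

lemma visits_changeAt {Ω : Type*} {d : ℕ} (Y Z : ℤ → Ω → Fin d → ℝ) (A : Set (Fin d → ℝ))
    (k l : ℕ) (ω : Ω) :
    visits (changeAt Y Z l ω) A k = visits (fun i => Y i ω) A (min k l) +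
      (visits (fun i => Z i ω) A k - visits (fun i => Z i ω) A (min k l)) := by
  have hY : ∀ n ≤ l, visits (changeAt Y Z l ω) A n = visits (fun i => Y i ω) A n := fun n hn =>
    Finset.sum_congr rfl fun i hi => by
      rw [changeAt, if_pos ((Finset.mem_Icc.1 hi).2.trans hn)]
  rcases le_total k l with h | h
  · rw [min_eq_left h, hY k h]
    ring
  · rw [min_eq_right h, visits_sub_visits _ _ h, ← hY l le_rfl, ← sub_eq_iff_eq_add',
      visits_sub_visits _ _ h]
    refine Finset.sum_congr rfl fun i hi => ?_
    rw [changeAt, if_neg (by have := (Finset.mem_Icc.1 hi).1; omega)]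

section ChangePoint

variable {Ω : Type*} [MeasurableSpace Ω] {P : Measure Ω} {d : ℕ} {Y Z : ℤ → Ω → Fin d → ℝ}

lemma abs_visits_changeAt_sub_le (A : Set (Fin d → ℝ)) (k l : ℕ) (ω : Ω) :
    |visits (changeAt Y Z l ω) A k -
        brokenLine l (P.real (Y 0 ⁻¹' A)) (P.real (Z 0 ⁻¹' A)) k| ≤
      |centredCount P Y A (min k l) ω| + |centredCount P Z A k ω| +
        |centredCount P Z A (min k l) ω| := by
  have h : visits (changeAt Y Z l ω) A k -
        brokenLine l (P.real (Y 0 ⁻¹' A)) (P.real (Z 0 ⁻¹' A)) k =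
      centredCount P Y A (min k l) ω + centredCount P Z A k ω -
        centredCount P Z A (min k l) ω := by
    have hc : ∀ (W : ℤ → Ω → Fin d → ℝ) n, centredCount P W A n ω =
      visits (fun i => W i ω) A n - n * P.real (W 0 ⁻¹' A) := fun W n => rfl
    rw [visits_changeAt, brokenLine, hc, hc, hc]
    ring
  rw [h]
  exact (abs_sub _ _).trans (add_le_add_left (abs_add_le _ _) _)

/-- Stated for an indexed family of sets so as to serve both all orthants simultaneously and a
single measurable set. The factor `3 τ` shares `ε m` among three centred counts observed up to time
`m τ`. -/
lemma tendsto_measure_exists_changeAt {ι : Type*} (A : ι → Set (Fin d → ℝ))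
    (hY : ∀ ε > 0, Tendsto (fun n : ℕ =>
      P {ω | ∃ k ≤ n, ∃ i, ε * n < |centredCount P Y (A i) k ω|}) atTop (𝓝 0))
    (hZ : ∀ ε > 0, Tendsto (fun n : ℕ =>
      P {ω | ∃ k ≤ n, ∃ i, ε * n < |centredCount P Z (A i) k ω|}) atTop (𝓝 0))
    (c : ℝ) {τ : ℝ} (hτ : 0 < τ) {ε : ℝ} (hε : 0 < ε) :
    Tendsto (fun m : ℕ => P {ω | ∃ k ≤ ⌊(m : ℝ) * τ⌋₊, ∃ i,
      ε * m < |visits (changeAt Y Z ⌊(m : ℝ) * c⌋₊ ω) (A i) k -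
        brokenLine ⌊(m : ℝ) * c⌋₊ (P.real (Y 0 ⁻¹' A i)) (P.real (Z 0 ⁻¹' A i)) k|})
      atTop (𝓝 0) := by
  have hε' : 0 < ε / (3 * τ) := by positivity
  have hfl : Tendsto (fun m : ℕ => ⌊(m : ℝ) * τ⌋₊) atTop atTop :=
    tendsto_nat_floor_atTop.comp (tendsto_natCast_atTop_atTop.atTop_mul_const hτ)
  have hlim := ((hY _ hε').comp hfl).add ((hZ _ hε').comp hfl)
  rw [add_zero] at hlim
  refine tendsto_of_tendsto_of_tendsto_of_le_of_le tendsto_const_nhds hlim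
    (fun _ => zero_le) fun m => (measure_mono ?_).trans (measure_union_le _ _)
  rintro ω ⟨k, hk, i, hi⟩
  by_contra hcon
  simp only [Set.mem_union, Set.mem_ofPred_eq, not_or, not_exists, not_and, not_lt] at hcon
  have hk' : min k ⌊(m : ℝ) * c⌋₊ ≤ ⌊(m : ℝ) * τ⌋₊ := (min_le_left _ _).trans hk
  have h1 := hcon.1 _ hk' i
  have h2 := hcon.2 _ hk i
  have h3 := hcon.2 _ hk' i
  have h4 := abs_visits_changeAt_sub_le (P := P) (Y := Y) (Z := Z) (A i) k ⌊(m : ℝ) * c⌋₊ ω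
  have h5 : (⌊(m : ℝ) * τ⌋₊ : ℝ) ≤ m * τ := Nat.floor_le (by positivity)
  have h6 : ε / (3 * τ) * ⌊(m : ℝ) * τ⌋₊ ≤ ε / (3 * τ) * (m * τ) := by gcongr
  have h7 : ε / (3 * τ) * (m * τ) = ε * m / 3 := by field_simp
  linarith

variable {F G : (Fin d → ℝ) → ℝ} {c τ : ℝ}

lemma tendsto_measure_zero_of_eventually_subset {E N : ℕ → Set Ω}
    (h : ∀ᶠ m in atTop, E m ⊆ N m) (hN : Tendsto (fun m => P (N m)) atTop (𝓝 0)) :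
    Tendsto (fun m => P (E m)) atTop (𝓝 0) :=
  tendsto_of_tendsto_of_tendsto_of_le_of_le' tendsto_const_nhds hN
    (Eventually.of_forall fun _ => zero_le) (h.mono fun _ hm => measure_mono hm)

lemma tendstoInProbLinfty_procH {x : ℕ → Ω → ℕ → Fin d → ℝ} {T : ℝ} (hc0 : 0 ≤ c)
    (hcT : c ≤ T + 1) (hFG : ∀ y, |F y - G y| ≤ 1)
    (hx : ∀ η > 0, Tendsto (fun m => P {ω | ¬ NearCentre F G c (T + 1) η m (x m ω)}) atTop (𝓝 0)) :
    TendstoInProbLinfty P (Delta T ×ˢ (Set.univ : Set (Fin d → ℝ)))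
      (fun m ω p => (√(m : ℝ))⁻¹ * procH m (x m ω) p.1.1 p.1.2 p.2)
      (fun p => limK c F G p.1.1 p.1.2 p.2) := by
  refine ⟨fun m ω => ⟨(T + 1) * (T + 1), ?_⟩, ⟨(T + 1) * (T + 1), ?_⟩, fun ε hε => ?_⟩
  · rintro _ ⟨p, ⟨⟨h1, h2, h3⟩, -⟩, rfl⟩
    exact abs_inv_sqrt_mul_procH_le m _ h1 h2 h3 _
  · rintro _ ⟨p, ⟨⟨h1, h2, h3⟩, -⟩, rfl⟩
    exact abs_limK_le hc0 hcT (hFG _) h1 h2 h3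
  -- Only the unweighted half is used; the weight parameters are arbitrary admissible values.
  · obtain ⟨η, hη, M, hM⟩ := exists_procHq_close (γ := 0) (δ := 1) le_rfl one_pos hc0 hcT hFG hε
    refine tendsto_measure_zero_of_eventually_subset ?_ (hx η hη)
    filter_upwards [eventually_ge_atTop M] with m hm ω hω hnear
    refine (not_lt.2 (Real.iSup_le (fun p => ?_) hε.le)) hω
    obtain ⟨⟨h1, h2, h3⟩, -⟩ := p.2
    exact ((hM m hm).2 _ hnear _ _ h1 h2 h3 _).1

lemma tendstoInProbLinfty_procHq {γ δ : ℝ} (hγ : 0 ≤ γ) (hδ : 0 < δ)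
    {x : ℕ → Ω → ℕ → Fin d → ℝ} {T : ℝ} (hc0 : 0 ≤ c)
    (hcT : c ≤ T + 1) (hFG : ∀ y, |F y - G y| ≤ 1)
    (hx : ∀ η > 0, Tendsto (fun m => P {ω | ¬ NearCentre F G c (T + 1) η m (x m ω)}) atTop (𝓝 0)) :
    TendstoInProbLinfty P (Delta T ×ˢ (Set.univ : Set (Fin d → ℝ)))
      (fun m ω p => (√(m : ℝ))⁻¹ * procHq γ δ m (x m ω) p.1.1 p.1.2 p.2)
      (fun p => limK c F G p.1.1 p.1.2 p.2 / weightQ γ δ p.1.1 p.1.2) := by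
  have hdiv : ∀ {v : ℝ} (s t : ℝ), |v| ≤ (T + 1) * (T + 1) →
      |v / weightQ γ δ s t| ≤ (T + 1) * (T + 1) / δ := fun {v} s t hv => by
    rw [abs_div, abs_of_pos (hδ.trans_le (le_weightQ _ _ _ _))]
    exact div_le_div₀ (mul_self_nonneg _) hv hδ (le_weightQ _ _ _ _)
  refine ⟨fun m ω => ⟨(T + 1) * (T + 1) / δ, ?_⟩, ⟨(T + 1) * (T + 1) / δ, ?_⟩, fun ε hε => ?_⟩
  · rintro _ ⟨p, ⟨⟨h1, h2, h3⟩, -⟩, rfl⟩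
    simp only [procHq, ← mul_div_assoc]
    exact hdiv _ _ (abs_inv_sqrt_mul_procH_le m _ h1 h2 h3 _)
  · rintro _ ⟨p, ⟨⟨h1, h2, h3⟩, -⟩, rfl⟩
    exact hdiv _ _ (abs_limK_le hc0 hcT (hFG _) h1 h2 h3)
  · obtain ⟨η, hη, M, hM⟩ := exists_procHq_close hγ hδ hc0 hcT hFG hε
    refine tendsto_measure_zero_of_eventually_subset ?_ (hx η hη)
    filter_upwards [eventually_ge_atTop M] with m hm ω hω hnear
    refine (not_lt.2 (Real.iSup_le (fun p => ?_) hε.le)) hω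
    obtain ⟨⟨h1, h2, h3⟩, -⟩ := p.2
    exact ((hM m hm).2 _ hnear _ _ h1 h2 h3 _).2

/-- Uniform lower bound for the weighted differences after the change, at the points where the
two distribution functions differ by more than `θ`. -/
lemma exists_mul_sqrt_le_abs_procHq {γ δ : ℝ} (hγ : 0 ≤ γ) (hδ : 0 < δ) (hc0 : 0 < c) {c' : ℝ}
    (hc' : c' < τ) (hcτ : c ≤ τ) (hFG : ∀ y, |F y - G y| ≤ 1) {θ : ℝ} (hθ : 0 < θ) :
    ∃ κ > 0, ∃ η > 0, ∃ M : ℕ, ∀ m ≥ M, 0 < m ∧ ∀ x : ℕ → Fin d → ℝ, NearCentre F G c τ η m x →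
      ∀ s, c ≤ s → s ≤ c' → ∀ y, θ < |F y - G y| → κ * √(m : ℝ) ≤ |procHq γ δ m x s τ y| := by
  obtain ⟨Q, hQ⟩ := exists_weightQ_le hγ δ τ
  have hQ0 : 0 < Q := hδ.trans_le ((le_weightQ γ δ 0 0).trans
    (hQ 0 ⟨le_rfl, hc0.le.trans hcτ⟩ 0 ⟨le_rfl, hc0.le.trans hcτ⟩))
  -- For `s` between `c` and `c'` the limit is `c (τ - s) (F - G) / q`, of modulus at least `2 κ`;
  -- an approximation error of `κ` leaves `κ`. Staying below `c' < τ` keeps `τ - s` away from zero.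
  set κ := c * (τ - c') * θ / Q / 2 with hκ
  have hκ0 : 0 < κ := by
    have := sub_pos.2 hc'
    positivity
  obtain ⟨η, hη, M, hM⟩ := exists_procHq_close hγ hδ hc0.le hcτ hFG hκ0
  refine ⟨κ, hκ0, η, hη, M, fun m hm => ⟨(hM m hm).1, fun x hx s hcs hsc' y hy => ?_⟩⟩
  have hm' : (0 : ℝ) < m := Nat.cast_pos.2 (hM m hm).1
  have hs0 : 0 ≤ s := hc0.le.trans hcs
  have hsτ : s ≤ τ := hsc'.trans hc'.le
  have h1 := ((hM m hm).2 x hx s τ hs0 hsτ le_rfl y).2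
  have hw : weightQ γ δ s τ ≤ Q := hQ s ⟨hs0, hsτ⟩ τ ⟨hs0.trans hsτ, le_rfl⟩
  have hw0 : 0 < weightQ γ δ s τ := hδ.trans_le (le_weightQ _ _ _ _)
  have h2 : 2 * κ ≤ |limK c F G s τ y / weightQ γ δ s τ| := by
    rw [limK, min_eq_right hcs, max_eq_left (hcs.trans hsτ), max_eq_left hcs, abs_div, abs_mul,
      abs_of_pos hw0, abs_of_nonneg (mul_nonneg hc0.le (sub_nonneg.2 hsτ)), hκ,
      mul_div_cancel₀ _ two_ne_zero]
    have hsub : τ - c' ≤ τ - s := by linarith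
    have hsub0 : 0 ≤ τ - c' := by linarith
    gcongr
  have h3 : κ ≤ |(√(m : ℝ))⁻¹ * procHq γ δ m x s τ y| := by
    have h4 := abs_sub_abs_le_abs_sub (limK c F G s τ y / weightQ γ δ s τ)
      ((√(m : ℝ))⁻¹ * procHq γ δ m x s τ y)
    rw [abs_sub_comm] at h4
    linarith
  have hsq := Real.sqrt_pos.2 hm'
  rwa [abs_mul, abs_of_pos (inv_pos.2 hsq), inv_mul_eq_div, le_div_iff₀ hsq] at h3

lemma tendstoInProbTop_supDet_detR {γ δ : ℝ} (hγ : 0 ≤ γ) (hδ : 0 < δ)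
    {x : ℕ → Ω → ℕ → Fin d → ℝ} {T : ℝ} (hc1 : 1 ≤ c) (hcT : c < T + 1)
    (hFG : ∀ y, |F y - G y| ≤ 1) (hne : G ≠ F)
    (hx : ∀ η > 0, Tendsto (fun m => P {ω | ¬ NearCentre F G c (T + 1) η m (x m ω)}) atTop (𝓝 0)) :
    TendstoInProbTop P (fun m ω => supDet T m (detR γ δ m (x m ω))) := by
  intro B
  have hc0 : 0 < c := one_pos.trans_le hc1
  obtain ⟨y, hy⟩ := Function.ne_iff.1 hne
  have hy' : 0 < |F y - G y| := abs_pos.2 (sub_ne_zero.2 hy.symm)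
  obtain ⟨κ, hκ, η, hη, M, hM⟩ := exists_mul_sqrt_le_abs_procHq hγ hδ hc0 hcT hcT.le hFG
    (half_pos hy')
  refine tendsto_measure_zero_of_eventually_subset ?_ (hx η hη)
  have hsqrt : Tendsto (fun m : ℕ => κ * √(m : ℝ)) atTop atTop :=
    (Real.tendsto_sqrt_atTop.comp tendsto_natCast_atTop_atTop).const_mul_atTop hκ
  have hgap : ∀ᶠ m : ℕ in atTop, 1 ≤ (m : ℝ) * (T + 1 - c) :=
    (tendsto_natCast_atTop_atTop.atTop_mul_const (sub_pos.2 hcT)).eventually_ge_atTop 1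
  filter_upwards [eventually_ge_atTop M, hsqrt.eventually_gt_atTop B, hgap] with m hm hB hgap ω hω
    hnear
  have h1 := (hM m hm).2 _ hnear c le_rfl le_rfl y (half_lt_self hy')
  rw [procHq_eq_wdiff γ δ (hM m hm).1] at h1
  have hmc : m ≤ ⌊(m : ℝ) * c⌋₊ := Nat.le_floor (le_mul_of_one_le_right (Nat.cast_nonneg m) hc1)
  -- The change point must be strictly below the last time to enter the maximum.
  have hlt : ⌊(m : ℝ) * c⌋₊ + 1 ≤ ⌊(m : ℝ) * (T + 1)⌋₊ := by
    rw [← Nat.floor_add_one (by positivity)]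
    exact Nat.floor_mono (by linarith)
  have h2 := abs_wdiff_le_detR γ δ (x m ω) (Set.mem_Ico.2 ⟨hmc, hlt⟩) y
  have h3 := le_supDet m (detR γ δ m (x m ω)) (t := T + 1) ⟨by linarith, le_rfl⟩
  exact absurd (hB.trans_le (h1.trans (h2.trans h3))) (not_lt.2 hω)

/-- A positive fraction of the candidate change points and a positive fraction of the observations
each contribute squares of order `m`, so the double average is itself of order `m`. -/
lemma tendstoInProbTop_detT {γ δ : ℝ} (hγ : 0 ≤ γ) (hδ : 0 < δ)
    {x : ℕ → Ω → ℕ → Fin d → ℝ} {T : ℝ} (hc1 : 1 ≤ c) (hcT : c < T + 1)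
    (hFG : ∀ y, |F y - G y| ≤ 1)
    (hx : ∀ η > 0, Tendsto (fun m => P {ω | ¬ NearCentre F G c (T + 1) η m (x m ω)}) atTop (𝓝 0))
    {θ ρ : ℝ} (hθ : 0 < θ) (hρ : 0 < ρ)
    (hv : Tendsto (fun m : ℕ => P {ω | visits (x m ω) {y | θ < |F y - G y|} ⌊(m : ℝ) * (T + 1)⌋₊ <
      ρ * m}) atTop (𝓝 0)) :
    TendstoInProbTop P (fun m ω => detT γ δ m (x m ω) ⌊(m : ℝ) * (T + 1)⌋₊) := by
  intro B
  have hc0 : 0 < c := one_pos.trans_le hc1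
  have hτ : 0 < T + 1 := hc0.trans hcT
  obtain ⟨c', hcc', hc'⟩ := exists_between hcT
  obtain ⟨κ, hκ, η, hη, M, hM⟩ := exists_mul_sqrt_le_abs_procHq hγ hδ hc0 hc' hcT.le hFG hθ
  have hN := (hx η hη).add hv
  rw [add_zero] at hN
  have hN' := tendsto_of_tendsto_of_tendsto_of_le_of_le tendsto_const_nhds hN
    (fun _ => zero_le) fun m => measure_union_le (μ := P) _ _
  refine tendsto_measure_zero_of_eventually_subset ?_ hN'
  have hD : 0 < c' - c := sub_pos.2 hcc'
  have hgrow : Tendsto (fun m : ℕ => (c' - c) / 2 * (κ ^ 2 * ρ) / (T + 1) * (m : ℝ)) atTop atTop :=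
    tendsto_natCast_atTop_atTop.const_mul_atTop (by positivity)
  have hgap : ∀ᶠ m : ℕ in atTop, 1 ≤ (m : ℝ) * (T + 1 - c') :=
    (tendsto_natCast_atTop_atTop.atTop_mul_const (sub_pos.2 hc')).eventually_ge_atTop 1
  have hgap' : ∀ᶠ m : ℕ in atTop, 2 ≤ (m : ℝ) * (c' - c) :=
    (tendsto_natCast_atTop_atTop.atTop_mul_const hD).eventually_ge_atTop 2
  filter_upwards [eventually_ge_atTop M, hgrow.eventually_gt_atTop B, hgap, hgap'] with
    m hm hB hgap hgap' ω hω
  by_contra hcon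
  simp only [Set.mem_union, Set.mem_ofPred_eq, not_or, not_not, not_lt] at hcon
  obtain ⟨hnear, hvis⟩ := hcon
  have hm0 := (hM m hm).1
  have hm' : (0 : ℝ) < m := Nat.cast_pos.2 hm0
  have hmc : m ≤ ⌊(m : ℝ) * c⌋₊ := Nat.le_floor (le_mul_of_one_le_right (Nat.cast_nonneg m) hc1)
  have hlt : ⌊(m : ℝ) * c'⌋₊ + 1 ≤ ⌊(m : ℝ) * (T + 1)⌋₊ := by
    rw [← Nat.floor_add_one (mul_nonneg hm'.le (hc0.trans hcc').le)]
    exact Nat.floor_mono (by linarith)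
  -- Excluding `⌊m c⌋` ensures `c ≤ j / m`, as the lower bound for the weighted difference requires.
  have hJ : Finset.Ioc ⌊(m : ℝ) * c⌋₊ ⌊(m : ℝ) * c'⌋₊ ⊆ Finset.Ico m ⌊(m : ℝ) * (T + 1)⌋₊ := by
    intro j hj
    rw [Finset.mem_Ioc] at hj
    rw [Finset.mem_Ico]
    omega
  have key := le_detT γ δ (x m ω) hJ {y | θ < |F y - G y|} (κ := κ ^ 2 * m) fun j hj y hy => by
    rw [Finset.mem_Ioc] at hj
    have h1 : c ≤ (j : ℝ) / m := by
      rw [le_div_iff₀ hm', mul_comm]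
      exact ((Nat.floor_lt (by positivity)).1 hj.1).le
    have h2 : (j : ℝ) / m ≤ c' := by
      rw [div_le_iff₀ hm', mul_comm]
      exact (Nat.le_floor_iff (mul_nonneg hm'.le (hc0.trans hcc').le)).1 hj.2
    have h3 := (hM m hm).2 _ hnear _ h1 h2 y hy
    rw [← wdiff_eq_procHq γ δ hm0] at h3
    have h4 : κ ^ 2 * m = (κ * √(m : ℝ)) ^ 2 := by rw [mul_pow, Real.sq_sqrt hm'.le]
    rw [h4, ← sq_abs (wdiff γ δ m (x m ω) j _ y)]
    gcongr
  have hcard : (m : ℝ) * ((c' - c) / 2) ≤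
      ((Finset.Ioc ⌊(m : ℝ) * c⌋₊ ⌊(m : ℝ) * c'⌋₊).card : ℝ) := by
    rw [Nat.card_Ioc, Nat.cast_sub (Nat.floor_mono (by gcongr))]
    have h1 := Nat.lt_floor_add_one ((m : ℝ) * c')
    have h2 := Nat.floor_le (a := (m : ℝ) * c) (by positivity)
    linarith
  have hkpos : (0 : ℝ) < ⌊(m : ℝ) * (T + 1)⌋₊ := Nat.cast_pos.2 (by omega)
  have hkle : (⌊(m : ℝ) * (T + 1)⌋₊ : ℝ) ≤ m * (T + 1) := Nat.floor_le (by positivity)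
  have hlow : (c' - c) / 2 * (κ ^ 2 * ρ) / (T + 1) * m ≤ (1 / (m : ℝ)) *
      ((Finset.Ioc ⌊(m : ℝ) * c⌋₊ ⌊(m : ℝ) * c'⌋₊).card * ((1 / (⌊(m : ℝ) * (T + 1)⌋₊ : ℝ)) *
        (κ ^ 2 * m * visits (x m ω) {y | θ < |F y - G y|} ⌊(m : ℝ) * (T + 1)⌋₊))) := by
    calc _ = (1 / (m : ℝ)) * (m * ((c' - c) / 2) * ((1 / (m * (T + 1))) *
          (κ ^ 2 * m * (ρ * m)))) := by field_simp
      _ ≤ _ := by gcongr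
  exact absurd (hB.trans_le (hlow.trans key)) (not_lt.2 hω)

lemma exists_tendsto_measure_visits_lt {A : Set (Fin d → ℝ)}
    (hA : ∀ ε > 0, Tendsto (fun m : ℕ => P {ω | ∃ k ≤ ⌊(m : ℝ) * τ⌋₊, ∃ _i : Unit,
      ε * m < |visits (changeAt Y Z ⌊(m : ℝ) * c⌋₊ ω) A k -
        brokenLine ⌊(m : ℝ) * c⌋₊ (P.real (Y 0 ⁻¹' A)) (P.real (Z 0 ⁻¹' A)) k|}) atTop (𝓝 0))
    [IsProbabilityMeasure P] (hc0 : 0 < c) (hcτ : c < τ)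
    (hpos : 0 < P.real (Y 0 ⁻¹' A) ∨ 0 < P.real (Z 0 ⁻¹' A)) :
    ∃ ρ > 0, Tendsto (fun m : ℕ => P {ω | visits (changeAt Y Z ⌊(m : ℝ) * c⌋₊ ω) A
      ⌊(m : ℝ) * τ⌋₊ < ρ * m}) atTop (𝓝 0) := by
  set p := P.real (Y 0 ⁻¹' A)
  set q := P.real (Z 0 ⁻¹' A)
  have hp0 : 0 ≤ p := measureReal_nonneg
  have hq0 : 0 ≤ q := measureReal_nonneg
  have hp1 : p ≤ 1 := measureReal_le_one
  have hq1 : q ≤ 1 := measureReal_le_one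
  have hτc : 0 < τ - c := sub_pos.2 hcτ
  have hD : 0 < c * p + (τ - c) * q := by
    rcases hpos with h | h
    · have := mul_pos hc0 h
      have := mul_nonneg hτc.le hq0
      linarith
    · have := mul_nonneg hc0.le hp0
      have := mul_pos hτc h
      linarith
  set D := c * p + (τ - c) * q with hDdef
  -- The centre at the last time is `m D` up to a rounding loss of at most `2`. One third of `m D`
  -- absorbs the deviation, one third the rounding, and one third remains.
  refine ⟨D / 3, by positivity, tendsto_measure_zero_of_eventually_subset ?_
    (hA (D / 3) (by positivity))⟩
  have hlarge : ∀ᶠ m : ℕ in atTop, 2 ≤ (m : ℝ) * (D / 3) :=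
    (tendsto_natCast_atTop_atTop.atTop_mul_const (by positivity)).eventually_ge_atTop 2
  filter_upwards [hlarge] with m hm ω hω
  refine ⟨_, le_rfl, (), ?_⟩
  by_contra! hcon
  have hle : ⌊(m : ℝ) * c⌋₊ ≤ ⌊(m : ℝ) * τ⌋₊ := Nat.floor_mono (by gcongr)
  rw [brokenLine, min_eq_right hle] at hcon
  have h1 := Nat.lt_floor_add_one ((m : ℝ) * τ)
  have h2 := Nat.lt_floor_add_one ((m : ℝ) * c)
  have h3 := Nat.floor_le (a := (m : ℝ) * c) (by positivity)
  have h4 : ((m : ℝ) * c - 1) * p ≤ ⌊(m : ℝ) * c⌋₊ * p :=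
    mul_le_mul_of_nonneg_right (by linarith) hp0
  have h5 : ((m : ℝ) * (τ - c) - 1) * q ≤ ((⌊(m : ℝ) * τ⌋₊ : ℝ) - ⌊(m : ℝ) * c⌋₊) * q :=
    mul_le_mul_of_nonneg_right (by linarith) hq0
  have h6 := (abs_le.1 hcon).1
  have h7 : visits (changeAt Y Z ⌊(m : ℝ) * c⌋₊ ω) A ⌊(m : ℝ) * τ⌋₊ < D / 3 * m := hω
  have h8 : (m : ℝ) * D = m * c * p + m * (τ - c) * q := by rw [hDdef]; ring
  linarith

end ChangePoint


/-! ### When distribution functions agree almost surely. -/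

section Identifiability

variable {d : ℕ}

lemma measurable_measureReal_Iic (μ : Measure (Fin d → ℝ)) [IsFiniteMeasure μ] :
    Measurable fun x => μ.real (Set.Iic x) := by
  have hs : MeasurableSet {p : (Fin d → ℝ) × (Fin d → ℝ) | p.2 ≤ p.1} :=
    measurableSet_le measurable_snd measurable_fst
  exact (measurable_measure_prodMk_left (ν := μ) hs).ennreal_toReal

lemma measurableSet_Iic_eq (μ ν : Measure (Fin d → ℝ)) [IsFiniteMeasure μ] [IsFiniteMeasure ν] :
    MeasurableSet {x | μ.real (Set.Iic x) = ν.real (Set.Iic x)} :=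
  measurableSet_eq_fun (measurable_measureReal_Iic μ) (measurable_measureReal_Iic ν)

/-- If the agreement set had full `μ`-measure, some compact part of it inside `Iic y` would have
`μ`-mass above `ν (Iic y)`. Its maximum `x` lies in the agreement set, so that mass is at most `μ
(Iic x) = ν (Iic x) ≤ ν (Iic y)`. Continuity is not needed. -/
lemma measure_Iic_ne_of_lt (μ ν : Measure (Fin 1 → ℝ)) [IsFiniteMeasure μ] [IsFiniteMeasure ν]
    {y : Fin 1 → ℝ} (hy : ν.real (Set.Iic y) < μ.real (Set.Iic y)) :
    μ {x | μ.real (Set.Iic x) ≠ ν.real (Set.Iic x)} ≠ 0 := by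
  intro h0
  set C := {x | μ.real (Set.Iic x) = ν.real (Set.Iic x)} with hC
  have hCm : MeasurableSet C := measurableSet_Iic_eq μ ν
  have hCae : ∀ᵐ x ∂μ, x ∈ C := by
    rw [ae_iff]
    exact h0
  have hlt : ν (Set.Iic y) < μ (Set.Iic y ∩ C) := by
    rw [Set.inter_comm, Measure.measure_inter_eq_of_ae hCae]
    exact (ENNReal.toReal_lt_toReal (measure_ne_top _ _) (measure_ne_top _ _)).1 hy
  obtain ⟨K, hKS, hK, hKm⟩ := (measurableSet_Iic.inter hCm).exists_lt_isCompact_of_ne_top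
    (measure_ne_top _ _) hlt
  have hne : K.Nonempty := nonempty_of_measure_ne_zero (ne_bot_of_gt hKm)
  obtain ⟨x, hxK, hx⟩ := hK.exists_isMaxOn hne (continuous_apply (0 : Fin 1)).continuousOn
  have hKx : K ⊆ Set.Iic x := fun z hz i => by
    rw [Subsingleton.elim i 0]
    exact hx hz
  have hxC : μ (Set.Iic x) = ν (Set.Iic x) :=
    (ENNReal.toReal_eq_toReal_iff' (measure_ne_top _ _) (measure_ne_top _ _)).1 (hKS hxK).2
  have h1 := measure_mono (μ := μ) hKx
  have h2 := measure_mono (μ := ν) (Set.Iic_subset_Iic.2 (hKS hxK).1)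
  exact absurd (hKm.trans_le (h1.trans (hxC.le.trans h2))) (lt_irrefl _)

/-- Two measures whose distribution functions agree at the vertices of a box give the same mass
to the box. -/
lemma measureReal_box_eq (μ ν : Measure (Fin d → ℝ)) [IsFiniteMeasure μ] [IsFiniteMeasure ν]
    (x : Fin d → ℝ) {u : ℝ} (hu : 0 ≤ u)
    (h : ∀ v : Fin d → ℝ, (∀ i, v i = x i ∨ v i = x i + u) →
      μ.real (Set.Iic v) = ν.real (Set.Iic v)) :
    μ.real (Set.univ.pi fun i => Set.Ioc (x i) (x i + u)) =
      ν.real (Set.univ.pi fun i => Set.Ioc (x i) (x i + u)) := by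
  classical
  -- Coordinates in `s` carry the bounded interval, the others a half-line. Inserting a coordinate
  -- writes the set as a difference of two sets of the previous stage, so the induction turns
  -- orthants into the box.
  set B : Finset (Fin d) → (Fin d → ℝ) → Set (Fin d → ℝ) := fun s v =>
    Set.univ.pi fun i => if i ∈ s then Set.Ioc (x i) (x i + u) else Set.Iic (v i) with hB
  have hmeas : ∀ s v, MeasurableSet (B s v) := fun s v =>
    MeasurableSet.univ_pi fun i => by
      split_ifs
      exacts [measurableSet_Ioc, measurableSet_Iic]
  have key : ∀ s v, (∀ i, v i = x i ∨ v i = x i + u) → μ.real (B s v) = ν.real (B s v) := by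
    intro s
    induction s using Finset.induction_on with
    | empty =>
      intro v hv
      have : B ∅ v = Set.Iic v := by
        ext z
        simp [hB, Pi.le_def]
      rw [this]
      exact h v hv
    | insert a s ha ih =>
      intro v hv
      have hdiff : B (insert a s) v =
          B s (Function.update v a (x a + u)) \ B s (Function.update v a (x a)) := by
        ext z
        simp only [hB, Set.mem_pi, Set.mem_univ, true_imp_iff, Set.mem_sdiff, not_forall,
          Finset.mem_insert]
        constructor
        · intro hz
          have hza := hz a
          rw [if_pos (Or.inl rfl)] at hza
          refine ⟨fun i => ?_, a, ?_⟩
          · rcases eq_or_ne i a with rfl | hia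
            · simpa [ha] using hza.2
            · simpa [hia] using hz i
          · simpa [ha] using hza.1
        · rintro ⟨hz, i, hi⟩ j
          have hia : i = a := by
            by_contra hia
            exact hi (by simpa [hia] using hz i)
          subst hia
          rcases eq_or_ne j i with rfl | hja
          · have := hz j
            simp only [ha, if_false, Function.update_self, Set.mem_Iic, not_le] at this hi
            simpa using ⟨hi, this⟩
          · simpa [hja] using hz j
      have hsub : B s (Function.update v a (x a)) ⊆ B s (Function.update v a (x a + u)) := by
        intro z hz i hi
        have := hz i hi
        rcases eq_or_ne i a with rfl | hia
        · simp only [ha, if_false, Function.update_self, Set.mem_Iic] at this ⊢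
          linarith
        · simpa [hia] using this
      have hupd : ∀ w, w = x a ∨ w = x a + u → ∀ i, Function.update v a w i = x i ∨
          Function.update v a w i = x i + u := by
        intro w hw i
        rcases eq_or_ne i a with rfl | hia
        · simpa using hw
        · simpa [hia] using hv i
      rw [hdiff, measureReal_sdiff hsub (hmeas _ _), measureReal_sdiff hsub (hmeas _ _),
        ih _ (hupd _ (Or.inl rfl)), ih _ (hupd _ (Or.inr rfl))]
  have := key Finset.univ x fun i => Or.inl rfl
  simpa [hB] using this

lemma tendsto_volume_sdiff_translate {K : Set (Fin d → ℝ)} (hK : IsCompact K) (e : Fin d → ℝ) :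
    Tendsto (fun u : ℝ => volume (K \ {x | x + u • e ∈ K})) (𝓝 0) (𝓝 0) := by
  have h := tendsto_measure_vadd_sdiff_isCompact_isClosed hK hK.isClosed
    (μ := (volume : Measure (Fin d → ℝ)))
  have hu : Tendsto (fun u : ℝ => u • e) (𝓝 0) (𝓝 0) := by
    have : Continuous fun u : ℝ => u • e := by fun_prop
    simpa using this.tendsto 0
  refine (h.comp hu).congr fun u => ?_
  rw [Function.comp_apply, ← measure_preimage_add_right volume (u • e)]
  congr 1
  ext x
  simp [Set.mem_vadd_set_iff_neg_vadd_mem, add_comm]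

/-- Almost every point of `K` is the lower corner of arbitrarily small cubes with all vertices in
`K`. Both measures give these cubes the same mass, and Lebesgue differentiation along them
identifies the densities. -/
lemma ae_rnDeriv_eq_of_isCompact (μ ν : Measure (Fin d → ℝ)) [IsFiniteMeasure μ]
    [IsFiniteMeasure ν] (hμ : μ ≪ volume) (hν : ν ≪ volume) {K : Set (Fin d → ℝ)}
    (hK : IsCompact K) (hKC : K ⊆ {x | μ.real (Set.Iic x) = ν.real (Set.Iic x)}) :
    ∀ᵐ x, x ∈ K → μ.rnDeriv volume x = ν.rnDeriv volume x := by
  classical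
  set e : Finset (Fin d) → Fin d → ℝ := fun S i => if i ∈ S then 1 else 0 with he
  -- The geometric bound makes the exceptional sets summable, so Borel–Cantelli puts all vertices in
  -- `K` for large `n`, at almost every point of `K`.
  have hu : ∀ n : ℕ, ∃ u : ℝ, 0 < u ∧ u < 1 / (n + 1) ∧
      ∀ S, volume (K \ {x | x + u • e S ∈ K}) ≤ (1 / 2 : ENNReal) ^ n := by
    intro n
    have h1 : ∀ᶠ u in 𝓝 (0 : ℝ), ∀ S, volume (K \ {x | x + u • e S ∈ K}) ≤ (1 / 2 : ENNReal) ^ n :=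
      eventually_all.2 fun S => (tendsto_volume_sdiff_translate hK (e S)).eventually_le_const
        (ENNReal.pow_pos (by simp) n)
    have h2 : ∀ᶠ u in 𝓝[>] (0 : ℝ), u ∈ Set.Ioo (0 : ℝ) (1 / (n + 1)) :=
      Ioo_mem_nhdsGT (by positivity)
    obtain ⟨u, hu1, hu2⟩ := ((h1.filter_mono nhdsWithin_le_nhds).and h2).exists
    exact ⟨u, hu2.1, hu2.2, hu1⟩
  choose u hu0 hun huS using hu
  have hBC : ∀ᵐ x : Fin d → ℝ, ∀ S, ∀ᶠ n in atTop, x ∉ K \ {x | x + u n • e S ∈ K} := by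
    refine ae_all_iff.2 fun S => ae_eventually_notMem ?_
    refine ne_top_of_le_ne_top ?_ (ENNReal.tsum_le_tsum fun n => huS n S)
    rw [ENNReal.tsum_geometric]
    simp
  have hulim : Tendsto (fun n => u n / 2) atTop (𝓝[>] 0) := by
    refine tendsto_nhdsWithin_iff.2 ⟨?_, Eventually.of_forall fun n => half_pos (hu0 n)⟩
    have h := squeeze_zero (fun n => (hu0 n).le) (fun n => (hun n).le)
      tendsto_one_div_add_atTop_nhds_zero_nat
    simpa using h.div_const 2
  -- In the sup metric cubes are balls. The point is a corner rather than the centre, at distance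
  -- exactly the radius, so constant `1` suffices.
  set V := IsUnifLocDoublingMeasure.vitaliFamily (volume : Measure (Fin d → ℝ)) 1
  filter_upwards [hBC, V.ae_tendsto_rnDeriv μ, V.ae_tendsto_rnDeriv ν] with x hx hxμ hxν hxK
  have hball : Tendsto (fun n => Metric.closedBall (x + fun _ => u n / 2) (u n / 2)) atTop
      (V.filterAt x) := by
    refine IsUnifLocDoublingMeasure.tendsto_closedBall_filterAt _ _ _ hulim
      (Eventually.of_forall fun n => ?_)
    rw [one_mul, Metric.mem_closedBall, dist_pi_le_iff (half_pos (hu0 n)).le]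
    intro i
    simp [abs_of_pos (hu0 n)]
  refine tendsto_nhds_unique (hxμ.comp hball) ((hxν.comp hball).congr' ?_)
  filter_upwards [eventually_all.2 hx] with n hn
  have hIcc : Metric.closedBall (x + fun _ => u n / 2) (u n / 2) =
      Set.Icc x (fun i => x i + u n) := by
    ext z
    rw [Metric.mem_closedBall, dist_pi_le_iff (half_pos (hu0 n)).le, Set.mem_Icc, Pi.le_def,
      Pi.le_def, ← forall_and]
    refine forall_congr' fun i => ?_
    rw [Pi.add_apply, Real.dist_eq, abs_le]
    constructor <;> rintro ⟨h1, h2⟩ <;> constructor <;> linarith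
  have hae : (Set.univ.pi fun i => Set.Ioc (x i) (x i + u n)) =ᵐ[volume]
      Set.Icc x (fun i => x i + u n) := Measure.univ_pi_Ioc_ae_eq_Icc
  have hbox := measureReal_box_eq μ ν x (hu0 n).le fun v hv => by
    have hvK : v ∈ K := by
      have h1 := hn (Finset.univ.filter fun i => v i = x i + u n)
      have h2 : x + u n • e (Finset.univ.filter fun i => v i = x i + u n) = v := by
        ext i
        by_cases hi : v i = x i + u n
        · simp [he, hi]
        · simp [he, (hv i).resolve_right hi]
      by_contra hvK
      exact h1 ⟨hxK, by rwa [Set.mem_ofPred_eq, h2]⟩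
    exact hKC hvK
  have hbox' := (ENNReal.toReal_eq_toReal_iff' (measure_ne_top _ _) (measure_ne_top _ _)).1 hbox
  simp only [Function.comp_apply]
  rw [hIcc, ← measure_congr (hμ.ae_eq hae), ← measure_congr (hν.ae_eq hae), hbox']

/-- Two absolutely continuous measures coincide if their distribution functions agree almost
everywhere with respect to both of them. -/
theorem eq_of_ae_Iic_eq (μ ν : Measure (Fin d → ℝ)) [IsFiniteMeasure μ] [IsFiniteMeasure ν]
    (hμ : μ ≪ volume) (hν : ν ≪ volume)
    (h₁ : μ {x | μ.real (Set.Iic x) ≠ ν.real (Set.Iic x)} = 0)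
    (h₂ : ν {x | μ.real (Set.Iic x) ≠ ν.real (Set.Iic x)} = 0) : μ = ν := by
  set C := {x | μ.real (Set.Iic x) = ν.real (Set.Iic x)} with hC
  have hCm : MeasurableSet C := measurableSet_Iic_eq μ ν
  -- Off the agreement set both densities vanish; on it, a non-null set of disagreement would
  -- contain a non-null compact set.
  have hout : ∀ (ρ : Measure (Fin d → ℝ)) [IsFiniteMeasure ρ], ρ ≪ volume → ρ Cᶜ = 0 →
      ∀ᵐ x, x ∉ C → ρ.rnDeriv volume x = 0 := by
    intro ρ _ hρ h0
    have h := Measure.setLIntegral_rnDeriv hρ Cᶜ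
    rw [h0, lintegral_eq_zero_iff (Measure.measurable_rnDeriv _ _)] at h
    exact (ae_restrict_iff' hCm.compl).1 h
  have hin : ∀ᵐ x, x ∈ C → μ.rnDeriv volume x = ν.rnDeriv volume x := by
    have hD : MeasurableSet {x | x ∈ C ∧ μ.rnDeriv volume x ≠ ν.rnDeriv volume x} :=
      hCm.inter (measurableSet_eq_fun (Measure.measurable_rnDeriv _ _)
        (Measure.measurable_rnDeriv _ _)).compl
    rw [ae_iff]
    simp only [Classical.not_imp]
    by_contra hne
    obtain ⟨K, hKD, hK, hKpos⟩ := hD.exists_lt_isCompact (pos_iff_ne_zero.2 hne)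
    have h := ae_rnDeriv_eq_of_isCompact μ ν hμ hν hK fun x hx => (hKD hx).1
    rw [ae_iff] at h
    refine hKpos.ne' (measure_mono_null (fun x hx => ?_) h)
    simp only [Set.mem_ofPred_eq, Classical.not_imp]
    exact ⟨hx, (hKD hx).2⟩
  have hae : μ.rnDeriv volume =ᵐ[volume] ν.rnDeriv volume := by
    filter_upwards [hin, hout μ hμ h₁, hout ν hν h₂] with x h1 h2 h3
    by_cases hx : x ∈ C
    · exact h1 hx
    · rw [h2 hx, h3 hx]
  rw [← Measure.withDensity_rnDeriv_eq μ volume hμ, ← Measure.withDensity_rnDeriv_eq ν volume hν,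
    withDensity_congr_ae hae]

end Identifiability


/-! ### Separation of the two laws and the final assembly. -/

section Separation

variable {Ω : Type*} [MeasurableSpace Ω] {P : Measure Ω} {d : ℕ}

lemma map_measureReal_Iic {X : Ω → Fin d → ℝ} (hX : Measurable X) (x : Fin d → ℝ) :
    (P.map X).real (Set.Iic x) = distFun P X x :=
  map_measureReal_apply hX measurableSet_Iic

variable [IsProbabilityMeasure P]

lemma measurable_distFun {X : Ω → Fin d → ℝ} (hX : Measurable X) : Measurable (distFun P X) := by
  have h := measurable_measureReal_Iic (P.map X)
  simpa only [map_measureReal_Iic hX] using h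

lemma abs_distFun_sub_le_one (X X' : Ω → Fin d → ℝ) (x : Fin d → ℝ) :
    |distFun P X x - distFun P X' x| ≤ 1 := by
  have h1 : 0 ≤ distFun P X x := measureReal_nonneg
  have h2 : 0 ≤ distFun P X' x := measureReal_nonneg
  have h3 : distFun P X x ≤ 1 := measureReal_le_one
  have h4 : distFun P X' x ≤ 1 := measureReal_le_one
  rw [abs_le]
  constructor <;> linarith

/-- The event that `F` and `G` differ is the countable union of its versions with gap above `1 / (n
+ 1)`, so one of them is not null. A uniform gap is what the lower bound on the detectors needs. -/
lemma exists_pos_measureReal_lt_abs_sub {X : Ω → Fin d → ℝ} {F G : (Fin d → ℝ) → ℝ}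
    (h : 0 < P {ω | F (X ω) ≠ G (X ω)}) :
    ∃ θ > 0, 0 < P.real (X ⁻¹' {y | θ < |F y - G y|}) := by
  have hU : {ω | F (X ω) ≠ G (X ω)} ⊆
      ⋃ n : ℕ, X ⁻¹' {y | (1 : ℝ) / (n + 1) < |F y - G y|} := fun ω hω => by
    obtain ⟨n, hn⟩ := exists_nat_one_div_lt (abs_pos.2 (sub_ne_zero.2 hω))
    exact Set.mem_iUnion.2 ⟨n, hn⟩
  by_contra! hcon
  refine h.ne' (measure_mono_null hU (measure_iUnion_null fun n => ?_))
  exact (measureReal_eq_zero_iff (measure_ne_top _ _)).1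
    (le_antisymm (hcon (1 / (n + 1)) (by positivity)) measureReal_nonneg)

/-- In dimension one, or for absolutely continuous laws, distinct distribution functions differ
with positive probability under one of the two laws. -/
lemma pos_measure_distFun_ne {X X' : Ω → Fin d → ℝ} (hX : Measurable X) (hX' : Measurable X')
    (hne : distFun P X' ≠ distFun P X)
    (h : d = 1 ∨ (P.map X ≪ volume ∧ P.map X' ≪ volume)) :
    0 < P {ω | distFun P X (X ω) ≠ distFun P X' (X ω)} ∨
      0 < P {ω | distFun P X (X' ω) ≠ distFun P X' (X' ω)} := by
  have := Measure.isProbabilityMeasure_map (μ := P) hX.aemeasurable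
  have := Measure.isProbabilityMeasure_map (μ := P) hX'.aemeasurable
  have hmeas := (measurableSet_eq_fun (measurable_distFun (P := P) hX)
    (measurable_distFun (P := P) hX')).compl
  have e : P {ω | distFun P X (X ω) ≠ distFun P X' (X ω)} =
      P.map X {x | distFun P X x ≠ distFun P X' x} := (Measure.map_apply hX hmeas).symm
  have e' : P {ω | distFun P X (X' ω) ≠ distFun P X' (X' ω)} =
      P.map X' {x | distFun P X x ≠ distFun P X' x} := (Measure.map_apply hX' hmeas).symm
  rw [e, e', pos_iff_ne_zero, pos_iff_ne_zero]
  rcases h with rfl | ⟨hac, hac'⟩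
  · obtain ⟨y, hy⟩ := Function.ne_iff.1 hne
    rcases hy.lt_or_gt with hlt | hlt
    · left
      have := measure_Iic_ne_of_lt (P.map X) (P.map X') (y := y)
      simp only [map_measureReal_Iic hX, map_measureReal_Iic hX'] at this
      exact this hlt
    · right
      have := measure_Iic_ne_of_lt (P.map X') (P.map X) (y := y)
      simp only [map_measureReal_Iic hX, map_measureReal_Iic hX'] at this
      simpa only [ne_comm] using this hlt
  · by_contra! hcon
    have := eq_of_ae_Iic_eq (P.map X) (P.map X') hac hac'
    simp only [map_measureReal_Iic hX, map_measureReal_Iic hX'] at this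
    refine hne (funext fun y => ?_)
    rw [← map_measureReal_Iic hX', ← map_measureReal_Iic hX, this hcon.1 hcon.2]

end Separation

end SeqChange

theorem proposition2p2 {Ω : Type*} [MeasurableSpace Ω] (P : Measure Ω) [IsProbabilityMeasure P]
    (d : ℕ) (T c γ δ : ℝ) (hT : 0 < T) (hc : 1 ≤ c) (hcT : c < T + 1)
    (hγ0 : 0 ≤ γ) (hγ1 : γ ≤ 1 / 2) (hδ0 : 0 < δ) (hδ1 : δ < 1)
    (Y Z : ℤ → Ω → Fin d → ℝ)
    (hYm : ∀ i, Measurable (Y i)) (hZm : ∀ i, Measurable (Z i))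
    (hYs : Stationary P Y) (hZs : Stationary P Z)
    (hYc : ContinuousVector P (Y 0)) (hZc : ContinuousVector P (Z 0))
    (a b : ℝ) (ha : 1 < a) (hb : 1 < b)
    (hYα : (fun r : ℕ => mixingCoeff P Y r) =O[atTop] fun r : ℕ => (r : ℝ) ^ (-a))
    (hZα : (fun r : ℕ => mixingCoeff P Z r) =O[atTop] fun r : ℕ => (r : ℝ) ^ (-b))
    (F G : (Fin d → ℝ) → ℝ) (hF : F = distFun P (Y 0)) (hG : G = distFun P (Z 0))
    (hFG : G ≠ F)
    (X : ℕ → Ω → ℕ → Fin d → ℝ) (hX : ∀ m, X m = changeAt Y Z ⌊(m : ℝ) * c⌋₊) :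
    TendstoInProbLinfty P (Delta T ×ˢ (Set.univ : Set (Fin d → ℝ)))
        (fun m ω p => (√(m : ℝ))⁻¹ * procH m (X m ω) p.1.1 p.1.2 p.2)
        (fun p => limK c F G p.1.1 p.1.2 p.2) ∧
    TendstoInProbLinfty P (Delta T ×ˢ (Set.univ : Set (Fin d → ℝ)))
        (fun m ω p => (√(m : ℝ))⁻¹ * procHq γ δ m (X m ω) p.1.1 p.1.2 p.2)
        (fun p => limK c F G p.1.1 p.1.2 p.2 / weightQ γ δ p.1.1 p.1.2) ∧
    TendstoInProbTop P (fun m ω => supDet T m (detR γ δ m (X m ω))) ∧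
    ((d = 1 ∨ (P.map (Y 0) ≪ volume ∧ P.map (Z 0) ≪ volume) ∨
        0 < P {ω | F (Y 0 ω) ≠ G (Y 0 ω)} ∨ 0 < P {ω | F (Z 0 ω) ≠ G (Z 0 ω)}) →
      TendstoInProbTop P (fun m ω => supDet T m (detS γ δ m (X m ω))) ∧
      TendstoInProbTop P (fun m ω => supDet T m (detT γ δ m (X m ω)))) := by

  have hτ : 0 < T + 1 := by linarith
  have hc0 : 0 < c := one_pos.trans_le hc
  have hYsum := summable_mixingCoeff ha hYα
  have hZsum := summable_mixingCoeff hb hZα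
  have hdiff : ∀ y, |F y - G y| ≤ 1 := fun y => by
    rw [hF, hG]
    exact abs_distFun_sub_le_one _ _ _
  have hnear : ∀ η > 0, Tendsto (fun m => P {ω | ¬ NearCentre F G c (T + 1) η m (X m ω)})
      atTop (𝓝 0) := by
    intro η hη
    have h := tendsto_measure_exists_changeAt Set.Iic
      (fun ε hε => tendsto_measure_exists_centredCount_Iic hYs hYm hYc hYsum hε)
      (fun ε hε => tendsto_measure_exists_centredCount_Iic hZs hZm hZc hZsum hε) c hτ hη
    refine h.congr fun m => ?_
    congr 1
    ext ω
    simp only [NearCentre, not_forall, not_le, hX, hF, hG, Set.mem_ofPred_eq, exists_prop]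
    rfl
  refine ⟨tendstoInProbLinfty_procH hc0.le hcT.le hdiff hnear,
    tendstoInProbLinfty_procHq hγ0 hδ0 hc0.le hcT.le hdiff hnear,
    tendstoInProbTop_supDet_detR hγ0 hδ0 hc hcT hdiff hFG hnear, fun hcond => ?_⟩
  have hsep : 0 < P {ω | F (Y 0 ω) ≠ G (Y 0 ω)} ∨ 0 < P {ω | F (Z 0 ω) ≠ G (Z 0 ω)} := by
    subst hF hG
    rcases hcond with h | h | h
    · exact pos_measure_distFun_ne (hYm 0) (hZm 0) hFG (Or.inl h)
    · exact pos_measure_distFun_ne (hYm 0) (hZm 0) hFG (Or.inr h)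
    · exact h
  obtain ⟨θ, hθ, hpos⟩ : ∃ θ > 0, 0 < P.real (Y 0 ⁻¹' {y | θ < |F y - G y|}) ∨
      0 < P.real (Z 0 ⁻¹' {y | θ < |F y - G y|}) := by
    rcases hsep with h | h
    · obtain ⟨θ, hθ, h⟩ := exists_pos_measureReal_lt_abs_sub h
      exact ⟨θ, hθ, Or.inl h⟩
    · obtain ⟨θ, hθ, h⟩ := exists_pos_measureReal_lt_abs_sub h
      exact ⟨θ, hθ, Or.inr h⟩
  have hA : MeasurableSet {y | θ < |F y - G y|} := by
    have hFm : Measurable F := hF ▸ measurable_distFun (hYm 0)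
    have hGm : Measurable G := hG ▸ measurable_distFun (hZm 0)
    exact measurableSet_lt measurable_const (continuous_abs.measurable.comp (hFm.sub hGm))
  -- The set where the gap exceeds `θ` is no orthant, but it is fixed, so the weak law without
  -- brackets applies, through a one-element family.
  obtain ⟨ρ, hρ, hvis⟩ := exists_tendsto_measure_visits_lt (fun ε hε =>
    tendsto_measure_exists_changeAt (fun _ : Unit => {y | θ < |F y - G y|})
      (fun ε hε => by simpa using tendsto_measure_exists_centredCount hYs hYm hYsum hA hε)
      (fun ε hε => by simpa using tendsto_measure_exists_centredCount hZs hZm hZsum hA hε)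
      c hτ hε) hc0 hcT hpos
  simp only [← hX] at hvis
  have hdetT := tendstoInProbTop_detT hγ0 hδ0 hc hcT hdiff hnear hθ hρ hvis
  have hmem : T + 1 ∈ Set.Icc 1 (T + 1) := ⟨by linarith, le_rfl⟩
  refine ⟨fun M => ?_, fun M => ?_⟩
  · refine tendsto_measure_zero_of_eventually_subset (Eventually.of_forall fun m ω hω => ?_)
      (hdetT (T * M))
    exact (detT_le_mul_detS hT.le γ δ m (X m ω)).trans
      (mul_le_mul_of_nonneg_left ((le_supDet m _ hmem).trans hω) hT.le)
  · exact tendsto_measure_zero_of_eventually_subset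
      (Eventually.of_forall fun m ω hω => (le_supDet m _ hmem).trans hω) (hdetT M)
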